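/- Let $\mathbb H^1=\mathbb R^3$ be the first Heisenberg group, with the left-invariant fields $X_1=\partial_x-\frac y2\partial_t$, $X_2=\partial_y+\frac x2\partial_t$, $T=\partial_t$ and the Riemannian metric for which they are orthonormal. Let $\mathcal S\subset\mathbb H^1$ be an oriented $C^2$ surface: near each of its points it is the zero set of a $C^2$ function $\phi$ whose Riemannian gradient $\boldsymbol N=\nabla\phi=X_1\phi\,X_1+X_2\phi\,X_2+T\phi\,T$ does not vanish and points to the side fixed by the orientation. Assume that the characteristic locus of $\mathcal S$ (the set of $g\in\mathcal S$ where $T_g\mathcal S=\mathrm{span}\{X_1(g),X_2(g)\}$) is empty. With such a local $\phi$, near each point of $\mathcal S$, put $$W=\sqrt{(X_1\phi)^2+(X_2\phi)^2},\quad \overline p=\frac{X_1\phi}{W},\quad \overline q=\frac{X_2\phi}{W},\quad \overline\omega=\frac{T\phi}{W},$$ $$Y=\boldsymbol\nu_H=\overline p X_1+\overline q X_2,\quad Z=\overline q X_1-\overline p X_2,\quad \mathcal H=X_1\overline p+X_2\overline q .$$ Let $\nabla^{H,\mathcal S}a=\nabla^H a-\langle\nabla^H a,\boldsymbol\nu_H\rangle\boldsymbol\nu_H$,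 where $\nabla^Ha=X_1a\,X_1+X_2a\,X_2$ is computed with any $C^2$ extension of $a$, and let $d\sigma_H=\frac{W}{|\boldsymbol N|}d\sigma$ be the $H$-perimeter measure of a surface, where $\sigma$ is its Riemannian surface measure. For a Borel set $E$ in a surface write $P_H(E)=\int_E d\sigma_H$, with $\sigma_H$ taken on that surface. Let $a\in C^2_0(\mathcal S)$, let $F_\lambda(g)=g+\lambda\,a(g)X_1(g)$ for $g\in\mathcal S$, and let $\mathcal S^\lambda=F_\lambda(\mathcal S)$ be the deformed surface. Let $E\subset\mathcal S$ be any Borel set which contains the support of $a$ and has $P_H(E)<\infty$ (for instance $E=\mathcal S$, if $P_H(\mathcal S)<\infty$). Then $P_H(F_\lambda(E))$, the $H$-perimeter of the portion $F_\lambda(E)$ of $\mathcal S^\lambda$, is finite for $\lambda$ near $0$ and is $C^2$ in $\lambda$ near $0$, both integrands below are $\sigma_H$-integrable on $\mathcal S$, and the second variation $$\mathcal V^H_{II}(\mathcal S;aX_1)=\frac{d^2}{d\lambda^2}P_H(F_\lambda(E))\Big|_{\lambda=0}$$ is given by $$\mathcal V^H_{II}(\mathcal S;aX_1)=\int_{\mathcal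 S}\overline p^2\,|\nabla^{H,\mathcal S}a|^2\,d\sigma_H+\int_{\mathcal S}a^2\Big\{(\overline pT\overline q+\overline qT\overline p)-\overline\omega(\overline pY\overline q+\overline qY\overline p)-\overline q^2\overline\omega^2-Z\overline\omega-\overline p\,\overline q\,\overline\omega\,\mathcal H\Big\}\,d\sigma_H .$$ -/

import Mathlib

open MeasureTheory Filter Topology Matrix

noncomputable section

namespace Heisenberg

/-- The underlying space of the first Heisenberg group, with coordinates `(x, y, t)` and group law
`(x, y, t) ∘ (x', y', t') = (x + x', y + y', t + t' + (x y' - x' y) / 2)`. -/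
abbrev Heis : Type := ℝ × ℝ × ℝ

/-- The left-invariant field `X₁ = ∂ₓ - (y/2) ∂ₜ`. -/
def X1 (g : Heis) : Heis := (1, 0, -(g.2.1 / 2))

/-- The left-invariant field `X₂ = ∂_y + (x/2) ∂ₜ`. -/
def X2 (g : Heis) : Heis := (0, 1, g.1 / 2)

/-- The left-invariant field `T = ∂ₜ`. -/
def T (_ : Heis) : Heis := (0, 0, 1)

/-- The derivative `V f` of a function along a vector field. -/
def along (V : Heis → Heis) (f : Heis → ℝ) (g : Heis) : ℝ := fderiv ℝ f g (V g)

/-- The coordinates of a vector `v` at `g` in the frame `X₁, X₂, T`, that is,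
`v = c 0 • X₁ g + c 1 • X₂ g + c 2 • T g`. The frame is orthonormal for the left-invariant
Riemannian metric, so these are the inner products of `v` with `X₁, X₂, T`. -/
def frameCoord (g v : Heis) : Fin 3 → ℝ :=
  ![v.1, v.2.1, v.2.2 + g.2.1 / 2 * v.1 - g.1 / 2 * v.2.1]

lemma frameCoord_spec (g v : Heis) :
    frameCoord g v 0 • X1 g + frameCoord g v 1 • X2 g + frameCoord g v 2 • T g = v := by
  obtain ⟨x, y, t⟩ := g
  obtain ⟨a, b, c⟩ := v
  simp only [frameCoord, X1, X2, T, Prod.smul_mk, Prod.mk_add_mk, smul_eq_mul]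
  refine Prod.ext ?_ (Prod.ext ?_ ?_) <;> simp
  ring

/-- The Riemannian gradient of `φ`, in the orthonormal frame `X₁, X₂, T`. -/
def rgrad (φ : Heis → ℝ) (g : Heis) : Fin 3 → ℝ :=
  ![along X1 φ g, along X2 φ g, along T φ g]

/-! ### The horizontal perimeter measure of a surface -/

/-- `θ`, on the open set `U` of the parameter plane, is a regular injective `C¹` parametrization
of a piece of `M`. -/
structure IsPatch (M : Set Heis) (U : Set (ℝ × ℝ)) (θ : ℝ × ℝ → Heis) : Prop where
  isOpen : IsOpen U
  contDiffOn : ContDiffOn ℝ 1 θ U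
  injOn : Set.InjOn θ U
  immersion : ∀ u ∈ U, Function.Injective (fderiv ℝ θ u)
  mapsTo : Set.MapsTo θ U M

/-- The Riemannian normal `θ_u × θ_v` of a parametrization, in the orthonormal frame. Its length
is the Riemannian area density. -/
def patchNormal (θ : ℝ × ℝ → Heis) (u : ℝ × ℝ) : Fin 3 → ℝ :=
  frameCoord (θ u) (fderiv ℝ θ u (1, 0)) ⨯₃ frameCoord (θ u) (fderiv ℝ θ u (0, 1))

/-- The horizontal perimeter of a parametrized piece, as a measure on its image. The Riemannian
surface measure is `dσ = |N| du dv`, with `N = θ_u × θ_v`, and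
`dσ_H = (√(⟨N, X₁⟩² + ⟨N, X₂⟩²) / |N|) dσ = √(⟨N, X₁⟩² + ⟨N, X₂⟩²) du dv`. -/
def patchPerimeter (U : Set (ℝ × ℝ)) (θ : ℝ × ℝ → Heis) : Measure Heis :=
  Measure.map θ ((volume.restrict U).withDensity fun u =>
    ENNReal.ofReal (Real.sqrt (patchNormal θ u 0 ^ 2 + patchNormal θ u 1 ^ 2)))

/-- The `H`-perimeter measure `σ_H` of a surface `M`: the least measure that dominates the
`H`-perimeter of every parametrized piece of `M`. On an embedded `C¹` surface the measures of
different pieces agree where the pieces overlap, and countably many pieces cover `M`, so that this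
is the measure on `M` which restricts to `patchPerimeter` on each piece. -/
def perimeter (M : Set Heis) : Measure Heis :=
  ⨆ P : {P : Set (ℝ × ℝ) × (ℝ × ℝ → Heis) // IsPatch M P.1 P.2}, patchPerimeter P.1.1 P.1.2

/-! ### Oriented surfaces -/

/-- An oriented `C²` surface: a set which near each of its points `g` is the zero set of a `C²`
function `φ g` with nonvanishing gradient, the gradients of all these functions pointing to the
same side of the surface. -/
structure OrientedC2Surface where
  /-- the set of points of the surface -/
  carrier : Set Heis
  /-- the neighbourhood of a point of the surface on which it is given by an equation -/
  dom : Heis → Set Heis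
  /-- the local defining functions -/
  φ : Heis → Heis → ℝ
  isOpen_dom : ∀ g ∈ carrier, IsOpen (dom g)
  mem_dom : ∀ g ∈ carrier, g ∈ dom g
  contDiffOn : ∀ g ∈ carrier, ContDiffOn ℝ 2 (φ g) (dom g)
  rgrad_ne_zero : ∀ g ∈ carrier, ∀ h ∈ dom g, rgrad (φ g) h ≠ 0
  inter_dom : ∀ g ∈ carrier, carrier ∩ dom g = {h ∈ dom g | φ g h = 0}
  oriented : ∀ g ∈ carrier, ∀ g' ∈ carrier, ∀ h ∈ carrier ∩ dom g ∩ dom g',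
    ∃ c : ℝ, 0 < c ∧ rgrad (φ g) h = c • rgrad (φ g') h

/-- The horizontal plane at `g`. -/
def horizontalPlane (g : Heis) : Submodule ℝ Heis := Submodule.span ℝ {X1 g, X2 g}

/-- The tangent plane of the surface at a point `g` of it. -/
def OrientedC2Surface.tangentPlane (S : OrientedC2Surface) (g : Heis) : Submodule ℝ Heis :=
  LinearMap.ker (fderiv ℝ (S.φ g) g : Heis →ₗ[ℝ] ℝ)

/-- The characteristic locus. -/
def OrientedC2Surface.charLocus (S : OrientedC2Surface) : Set Heis :=
  {g ∈ S.carrier | S.tangentPlane g = horizontalPlane g}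

/-! ### The geometric quantities, computed from a defining function `φ` in a neighbourhood -/

/-- `W = √(p² + q²)`, where `p = X₁φ` and `q = X₂φ`. -/
def W (φ : Heis → ℝ) (g : Heis) : ℝ := Real.sqrt (along X1 φ g ^ 2 + along X2 φ g ^ 2)

/-- `p̄ = X₁φ / W`. -/
def pbar (φ : Heis → ℝ) (g : Heis) : ℝ := along X1 φ g / W φ g

/-- `q̄ = X₂φ / W`. -/
def qbar (φ : Heis → ℝ) (g : Heis) : ℝ := along X2 φ g / W φ g

/-- `ω̄ = Tφ / W`. -/
def omegabar (φ : Heis → ℝ) (g : Heis) : ℝ := along T φ g / W φ g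

/-- The horizontal Gauss map `Y = ν_H = p̄ X₁ + q̄ X₂`. -/
def Y (φ : Heis → ℝ) (g : Heis) : Heis := pbar φ g • X1 g + qbar φ g • X2 g

/-- `Z = ν_H^⊥ = q̄ X₁ - p̄ X₂`. -/
def Z (φ : Heis → ℝ) (g : Heis) : Heis := qbar φ g • X1 g - pbar φ g • X2 g

/-- The horizontal mean curvature `X₁p̄ + X₂q̄`. -/
def meanCurvature (φ : Heis → ℝ) (g : Heis) : ℝ :=
  along X1 (pbar φ) g + along X2 (qbar φ) g

/-- `|∇^{H,S} f|²`, where `∇^{H,S} f = ∇^H f - ⟨∇^H f, ν_H⟩ ν_H` and `∇^H f = X₁f X₁ + X₂f X₂`. -/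
def tangentialGradSq (φ f : Heis → ℝ) (g : Heis) : ℝ :=
  (along X1 f g - (along X1 f g * pbar φ g + along X2 f g * qbar φ g) * pbar φ g) ^ 2 +
  (along X2 f g - (along X1 f g * pbar φ g + along X2 f g * qbar φ g) * qbar φ g) ^ 2

/-- The coefficient of `a²` in the second variation along `a X₁`. -/
def potential (φ : Heis → ℝ) (g : Heis) : ℝ :=
  (pbar φ g * along T (qbar φ) g + qbar φ g * along T (pbar φ) g)
    - omegabar φ g * (pbar φ g * along (Y φ) (qbar φ) g + qbar φ g * along (Y φ) (pbar φ) g)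
    - qbar φ g ^ 2 * omegabar φ g ^ 2
    - along (Z φ) (omegabar φ) g
    - pbar φ g * qbar φ g * omegabar φ g * meanCurvature φ g

/-! ### Deformations and the second variation -/

/-- The deformation `g ↦ g + r 𝒳(g)`. -/
def deform (𝒳 : Heis → Heis) (r : ℝ) (g : Heis) : Heis := g + r • 𝒳 g

/-- The `H`-perimeter of the portion of the deformed surface `M + r 𝒳` that comes from `E ⊆ M`,
measured on the deformed surface. -/
def deformedPerimeter (M E : Set Heis) (𝒳 : Heis → Heis) (r : ℝ) : ENNReal :=
  perimeter (deform 𝒳 r '' M) (deform 𝒳 r '' E)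

/-- The second variation: the second derivative of the `H`-perimeter at `r = 0`. For fields with
compact support in `E` the part of the surface outside `E` does not move. -/
def secondVariation (M E : Set Heis) (𝒳 : Heis → Heis) : ℝ :=
  iteratedDeriv 2 (fun r => (deformedPerimeter M E 𝒳 r).toReal) 0

end Heisenberg

end

open Heisenberg

noncomputable section

namespace Heisenberg

/-! In a parametrization the horizontal perimeter has density `√(N₀² + N₁²)`, where `N` is the cross
product of the coordinate tangent vectors in the frame `X₁, X₂, T`. The map `g ↦ g + r a X₁` leaves
`N₀` unchanged and turns `N₁` into a quadratic polynomial in `r` (`patchNormal_deform`). Since `N`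
is parallel to `(p̄, q̄, ω̄)`, the perimeter gets multiplied by `√(p̄² + (q̄ + rB + r²C)²)` with `B
= Za + aω̄` and `C = a(ω̄ X₁a - p̄ Ta)` (`density_deform`). For small `r` the deformation extends to
a diffeomorphism of the ambient space (`exists_deform_homeomorph`), so this factor also transforms
the global measure (`perimeter_image`).

Because `p̄² + q̄² = 1` and `B`, `C` are bounded, the factor and its first two `r`-derivatives are
bounded uniformly over the surface for `r` near `0`. The measure on `E` is finite, so two
differentiations under the integral are allowed, and the second derivative at `0` is the integral of
`p̄²B² + 2q̄C`.

This integrand is not yet the stated one. The difference is `stokesDensity` of `a²`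
(`second_variation_density`), which is the exterior derivative of the one-form with frame components
`a²(-p̄q̄², p̄²q̄, -ω̄)`, evaluated on the surface (`stokesDensity_eq_curl`). By Stokes' formula it
integrates to zero (`integral_stokesDensity`): in charts this is the vanishing of integrals of
derivatives of compactly supported functions, and a partition of unity makes it global.

The defining functions are only local, and different ones agree only along the surface and up to a
positive factor. Hence the potential is rewritten with derivatives along the tangential fields `Z`
and `T - ω̄Y` only (`potential_eq`), and these do not see the choice. -/

/-! ### Calculus under the integral sign -/

/-- The integral of a directional derivative of a compactly supported `C¹` function vanishes. -/
lemma integral_fderiv_apply_eq_zero {G : ℝ × ℝ → ℝ} (hG : ContDiff ℝ 1 G)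
    (hc : HasCompactSupport G) (v : ℝ × ℝ) : ∫ u, fderiv ℝ G u v = 0 := by
  have hcont : Continuous fun u => fderiv ℝ G u v :=
    (hG.continuous_fderiv one_ne_zero).clm_apply continuous_const
  have hint : Integrable fun u => fderiv ℝ G u v :=
    hcont.integrable_of_hasCompactSupport (hc.fderiv_apply (𝕜 := ℝ) v)
  -- Integration by parts against the constant `1`, whose derivative is zero.
  have := integral_mul_fderiv_eq_neg_fderiv_mul_of_integrable
    (μ := (volume : Measure (ℝ × ℝ))) (f := fun _ : ℝ × ℝ => (1 : ℝ)) (g := G) (v := v)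
    (by simp) (by simpa using hint)
    (by simpa using hG.continuous.integrable_of_hasCompactSupport hc)
    (fun _ _ => differentiableAt_const _)
    (fun x _ => hG.differentiable one_ne_zero x)
  simpa using this

/-- Differentiating twice under the integral sign, with uniform bounds on a finite measure. -/
lemma contDiffAt_two_integral {α : Type*} [MeasurableSpace α] {μ : Measure α} [IsFiniteMeasure μ]
    {F F' F'' : ℝ → α → ℝ} {δ C : ℝ} (hδ : 0 < δ)
    (hm : ∀ r, AEStronglyMeasurable (F r) μ) (hm' : ∀ r, AEStronglyMeasurable (F' r) μ)
    (hm'' : ∀ r, AEStronglyMeasurable (F'' r) μ)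
    (hb : ∀ᵐ x ∂μ, ∀ r ∈ Metric.ball (0 : ℝ) δ, ‖F r x‖ ≤ C ∧ ‖F' r x‖ ≤ C ∧ ‖F'' r x‖ ≤ C)
    (hd : ∀ᵐ x ∂μ, ∀ r ∈ Metric.ball (0 : ℝ) δ,
      HasDerivAt (fun r => F r x) (F' r x) r ∧ HasDerivAt (fun r => F' r x) (F'' r x) r ∧
      ContinuousAt (fun r => F'' r x) r) :
    ContDiffAt ℝ 2 (fun r => ∫ x, F r x ∂μ) 0 ∧
      iteratedDeriv 2 (fun r => ∫ x, F r x ∂μ) 0 = ∫ x, F'' 0 x ∂μ := by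
  have hball : ∀ r ∈ Metric.ball (0 : ℝ) δ, Metric.ball (0 : ℝ) δ ∈ 𝓝 r := fun r hr =>
    Metric.isOpen_ball.mem_nhds hr
  have h0 : (0 : ℝ) ∈ Metric.ball (0 : ℝ) δ := Metric.mem_ball_self hδ
  have hi : ∀ G : ℝ → α → ℝ, (∀ r, AEStronglyMeasurable (G r) μ) →
      (∀ᵐ x ∂μ, ∀ r ∈ Metric.ball (0 : ℝ) δ, ‖G r x‖ ≤ C) →
      ∀ r ∈ Metric.ball (0 : ℝ) δ, Integrable (G r) μ := fun G hG hGb r hr =>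
    Integrable.of_bound (hG r) C (hGb.mono fun x hx => hx r hr)
  -- A single differentiation under the integral, applied below to `(F, F')` and to `(F', F'')`; the
  -- constant `C` is an integrable bound because the measure is finite.
  have key : ∀ G G' : ℝ → α → ℝ, (∀ r, AEStronglyMeasurable (G r) μ) →
      (∀ r, AEStronglyMeasurable (G' r) μ) →
      (∀ᵐ x ∂μ, ∀ r ∈ Metric.ball (0 : ℝ) δ, ‖G r x‖ ≤ C) →
      (∀ᵐ x ∂μ, ∀ r ∈ Metric.ball (0 : ℝ) δ, ‖G' r x‖ ≤ C) →
      (∀ᵐ x ∂μ, ∀ r ∈ Metric.ball (0 : ℝ) δ, HasDerivAt (fun r => G r x) (G' r x) r) →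
      ∀ r ∈ Metric.ball (0 : ℝ) δ,
        HasDerivAt (fun r => ∫ x, G r x ∂μ) (∫ x, G' r x ∂μ) r := by
    intro G G' hG hG' hGb hGb' hGd r hr
    exact (hasDerivAt_integral_of_dominated_loc_of_deriv_le (bound := fun _ => C) (hball r hr)
      (Eventually.of_forall hG) (hi G hG hGb r hr) (hG' r) hGb'
      (integrable_const C) hGd).2
  have d1 := key F F' hm hm' (hb.mono fun x hx r hr => (hx r hr).1)
    (hb.mono fun x hx r hr => (hx r hr).2.1) (hd.mono fun x hx r hr => (hx r hr).1)
  have d2 := key F' F'' hm' hm'' (hb.mono fun x hx r hr => (hx r hr).2.1)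
    (hb.mono fun x hx r hr => (hx r hr).2.2) (hd.mono fun x hx r hr => (hx r hr).2.1)
  have c2 : ContinuousOn (fun r => ∫ x, F'' r x ∂μ) (Metric.ball (0 : ℝ) δ) := by
    intro r hr
    refine (continuousAt_of_dominated (bound := fun _ => C) (Eventually.of_forall hm'') ?_
      (integrable_const C) (hd.mono fun x hx => (hx r hr).2.2)).continuousWithinAt
    filter_upwards [hball r hr] with s hs
    exact hb.mono fun x hx => (hx s hs).2.2
  have e1 : ∀ r ∈ Metric.ball (0 : ℝ) δ, deriv (fun r => ∫ x, F r x ∂μ) r = ∫ x, F' r x ∂μ :=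
    fun r hr => (d1 r hr).deriv
  have e2 : ∀ r ∈ Metric.ball (0 : ℝ) δ,
      deriv (deriv (fun r => ∫ x, F r x ∂μ)) r = ∫ x, F'' r x ∂μ := fun r hr => by
    have : deriv (fun r => ∫ x, F r x ∂μ) =ᶠ[𝓝 r] fun r => ∫ x, F' r x ∂μ := by
      filter_upwards [hball r hr] with s hs using e1 s hs
    rw [this.deriv_eq, (d2 r hr).deriv]
  refine ⟨?_, ?_⟩
  · have : ContDiffOn ℝ 2 (fun r => ∫ x, F r x ∂μ) (Metric.ball (0 : ℝ) δ) := by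
      rw [show (2 : WithTop ℕ∞) = 1 + 1 by norm_num,
        contDiffOn_succ_iff_deriv_of_isOpen Metric.isOpen_ball]
      refine ⟨fun r hr => (d1 r hr).differentiableAt.differentiableWithinAt, by simp, ?_⟩
      rw [show (1 : WithTop ℕ∞) = 0 + 1 by norm_num,
        contDiffOn_succ_iff_deriv_of_isOpen Metric.isOpen_ball]
      refine ⟨fun r hr => ?_, by simp, ?_⟩
      · have : deriv (fun r => ∫ x, F r x ∂μ) =ᶠ[𝓝 r] fun r => ∫ x, F' r x ∂μ := by
          filter_upwards [hball r hr] with s hs using e1 s hs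
        exact (this.differentiableAt_iff.2 (d2 r hr).differentiableAt).differentiableWithinAt
      · rw [contDiffOn_zero]
        exact c2.congr e2
    exact this.contDiffAt (hball 0 h0)
  · rw [iteratedDeriv_succ, iteratedDeriv_one]
    exact e2 0 h0

/-! ### Derivatives and bounds for the square root of the deformed density -/

/-- The first derivative of `r ↦ √(P² + (Q + r B + r² C)²)`, as a function of `r`. -/
def sqrtDeriv (P Q B C r : ℝ) : ℝ :=
  (Q + r * B + r ^ 2 * C) * (B + 2 * r * C) / √(P ^ 2 + (Q + r * B + r ^ 2 * C) ^ 2)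

/-- The second derivative of `r ↦ √(P² + (Q + r B + r² C)²)`, as a function of `r`. -/
def sqrtDeriv2 (P Q B C r : ℝ) : ℝ :=
  ((B + 2 * r * C) ^ 2 + (Q + r * B + r ^ 2 * C) * (2 * C)) /
      √(P ^ 2 + (Q + r * B + r ^ 2 * C) ^ 2) -
    ((Q + r * B + r ^ 2 * C) * (B + 2 * r * C)) ^ 2 /
      √(P ^ 2 + (Q + r * B + r ^ 2 * C) ^ 2) ^ 3

lemma hasDerivAt_sqrt_quadratic {P Q B C r : ℝ}
    (h : 0 < P ^ 2 + (Q + r * B + r ^ 2 * C) ^ 2) :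
    HasDerivAt (fun r => √(P ^ 2 + (Q + r * B + r ^ 2 * C) ^ 2)) (sqrtDeriv P Q B C r) r := by
  have h1 : HasDerivAt (fun r : ℝ => Q + r * B + r ^ 2 * C) (B + 2 * r * C) r := by
    have := (((hasDerivAt_id r).mul_const B).const_add Q).add
      (((hasDerivAt_id r).pow 2).mul_const C)
    refine this.congr_deriv ?_
    simp
  have h2 := ((h1.pow 2).const_add (P ^ 2)).sqrt h.ne'
  refine h2.congr_deriv ?_
  simp only [sqrtDeriv, Pi.pow_apply, Nat.cast_ofNat, Nat.add_one_sub_one, pow_one]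
  rw [mul_assoc, mul_div_mul_left _ _ two_ne_zero]

lemma hasDerivAt_sqrtDeriv {P Q B C r : ℝ}
    (h : 0 < P ^ 2 + (Q + r * B + r ^ 2 * C) ^ 2) :
    HasDerivAt (sqrtDeriv P Q B C) (sqrtDeriv2 P Q B C r) r := by
  have h1 : HasDerivAt (fun r : ℝ => Q + r * B + r ^ 2 * C) (B + 2 * r * C) r := by
    have := (((hasDerivAt_id r).mul_const B).const_add Q).add
      (((hasDerivAt_id r).pow 2).mul_const C)
    refine this.congr_deriv ?_
    simp
  have h2 : HasDerivAt (fun r : ℝ => B + 2 * r * C) (2 * C) r := by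
    have := (((hasDerivAt_id r).const_mul 2).mul_const C).const_add B
    refine this.congr_deriv ?_
    simp
  have h3 := hasDerivAt_sqrt_quadratic h
  have hs : √(P ^ 2 + (Q + r * B + r ^ 2 * C) ^ 2) ≠ 0 := (Real.sqrt_pos.2 h).ne'
  refine ((h1.mul h2).div h3 hs).congr_deriv ?_
  simp only [sqrtDeriv2, sqrtDeriv, Pi.mul_apply]
  field_simp

/-- To be read with `a = Q + rB + r²C`, `D` its derivative in `r`, and `s` the square root, which
stays above `1/2`. The quotients are then those of `sqrtDeriv` and `sqrtDeriv2`. The second bound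
adds up to `8 · 2 + 16 · 8 = 144` times `M²`; `200` is a convenient common constant. -/
lemma abs_div_le_of_bounds {a D C M s : ℝ} (hM : 1 ≤ M) (ha : |a| ≤ 2) (hD : |D| ≤ 2 * M)
    (hC : |C| ≤ M) (hs : 1 / 2 ≤ s) :
    |a * D / s| ≤ 200 * M ^ 2 ∧
      |(D ^ 2 + a * (2 * C)) / s - (a * D) ^ 2 / s ^ 3| ≤ 200 * M ^ 2 := by
  have hs0 : 0 < s := by linarith
  have hMM' : M ≤ M ^ 2 := by nlinarith
  have haD : |a * D| ≤ 4 * M := by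
    rw [abs_mul]
    calc |a| * |D| ≤ 2 * (2 * M) := mul_le_mul ha hD (abs_nonneg _) (by norm_num)
      _ = 4 * M := by ring
  have haD2 : |(a * D) ^ 2| ≤ 16 * M ^ 2 := by
    rw [abs_pow]
    calc |a * D| ^ 2 ≤ (4 * M) ^ 2 := pow_le_pow_left₀ (abs_nonneg _) haD 2
      _ = 16 * M ^ 2 := by ring
  have hD2 : |D ^ 2| ≤ 4 * M ^ 2 := by
    rw [abs_pow]
    calc |D| ^ 2 ≤ (2 * M) ^ 2 := pow_le_pow_left₀ (abs_nonneg _) hD 2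
      _ = 4 * M ^ 2 := by ring
  have haC : |a * (2 * C)| ≤ 4 * M := by
    rw [abs_mul, abs_mul, abs_two]
    calc |a| * (2 * |C|) ≤ 2 * (2 * M) :=
          mul_le_mul ha (by linarith) (by positivity) (by norm_num)
      _ = 4 * M := by ring
  have hn : |D ^ 2 + a * (2 * C)| ≤ 8 * M ^ 2 := (abs_add_le _ _).trans (by linarith)
  have hs3 : 1 / 8 ≤ s ^ 3 := by
    have : (1 / 2 : ℝ) ^ 3 ≤ s ^ 3 := pow_le_pow_left₀ (by norm_num) hs 3
    norm_num at this ⊢; exact this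
  have hinv : s⁻¹ ≤ 2 := by
    rw [inv_le_comm₀ hs0 two_pos]; linarith
  have hinv3 : (s ^ 3)⁻¹ ≤ 8 := by
    rw [inv_le_comm₀ (pow_pos hs0 3) (by norm_num)]; linarith
  have hi0 : 0 ≤ s⁻¹ := by positivity
  have hi3 : 0 ≤ (s ^ 3)⁻¹ := by positivity
  simp only [div_eq_mul_inv]
  constructor
  · rw [abs_mul, abs_of_nonneg hi0]
    calc _ ≤ 4 * M * 2 := mul_le_mul haD hinv hi0 (by positivity)
      _ ≤ _ := by linarith
  · refine (abs_sub _ _).trans ?_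
    rw [abs_mul, abs_mul, abs_of_nonneg hi0, abs_of_nonneg hi3]
    calc _ ≤ 8 * M ^ 2 * 2 + 16 * M ^ 2 * 8 := add_le_add
          (mul_le_mul hn hinv hi0 (by positivity)) (mul_le_mul haD2 hinv3 hi3 (by positivity))
      _ ≤ _ := by linarith [sq_nonneg M]

/-- Bounds that are uniform in the coefficients. -/
lemma sqrt_quadratic_bounds {P Q B C M r : ℝ} (hPQ : P ^ 2 + Q ^ 2 = 1) (hM : 1 ≤ M)
    (hB : |B| ≤ M) (hC : |C| ≤ M) (hr : |r| < 1 / (8 * M)) :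
    1 / 4 ≤ P ^ 2 + (Q + r * B + r ^ 2 * C) ^ 2 ∧
      |√(P ^ 2 + (Q + r * B + r ^ 2 * C) ^ 2)| ≤ 200 * M ^ 2 ∧
      |sqrtDeriv P Q B C r| ≤ 200 * M ^ 2 ∧ |sqrtDeriv2 P Q B C r| ≤ 200 * M ^ 2 := by
  have hM0 : 0 < M := by linarith
  have hrM : |r| * M ≤ 1 / 8 := by
    have : |r| * (8 * M) < 1 := by rwa [lt_div_iff₀ (by positivity)] at hr
    linarith
  have hrB : |r| * |B| ≤ 1 / 8 :=
    (mul_le_mul_of_nonneg_left hB (abs_nonneg r)).trans hrM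
  have hrC : |r| * |C| ≤ 1 / 8 :=
    (mul_le_mul_of_nonneg_left hC (abs_nonneg r)).trans hrM
  have hr1 : |r| ≤ 1 / 8 := (le_mul_of_one_le_right (abs_nonneg r) hM).trans hrM
  have he' : |r * B + r ^ 2 * C| ≤ 1 / 4 := by
    have h1 : |r * B| ≤ 1 / 8 := by rwa [abs_mul]
    have h2 : |r ^ 2 * C| ≤ 1 / 8 := by
      rw [abs_mul, abs_pow, sq, mul_assoc]
      calc |r| * (|r| * |C|) ≤ 1 * (1 / 8) := mul_le_mul (by linarith) hrC (by positivity) one_pos.le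
        _ = 1 / 8 := one_mul _
    exact (abs_add_le _ _).trans (by linarith)
  have hQ : |Q| ≤ 1 := by
    rw [← sq_le_one_iff_abs_le_one]; nlinarith [sq_nonneg P]
  have hD : |B + 2 * r * C| ≤ 2 * M := by
    refine (abs_add_le _ _).trans ?_
    rw [abs_mul, abs_mul, abs_two]
    linarith
  have hQe : Q + r * B + r ^ 2 * C = Q + (r * B + r ^ 2 * C) := by ring
  simp only [sqrtDeriv, sqrtDeriv2, hQe]
  generalize r * B + r ^ 2 * C = e at he' ⊢
  generalize B + 2 * r * C = D at hD ⊢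
  obtain ⟨e1, e2⟩ := abs_le.1 he'
  obtain ⟨q1, q2⟩ := abs_le.1 hQ
  -- The radicand is `1 + 2Qe + e²` with `|Q| ≤ 1` and `|e| ≤ 1/4`; this is what the restriction
  -- `|r| < 1 / (8M)` is for.
  have hlow : 1 / 4 ≤ P ^ 2 + (Q + e) ^ 2 := by nlinarith
  have hup : P ^ 2 + (Q + e) ^ 2 ≤ 4 := by nlinarith
  have hQE : |Q + e| ≤ 2 := by rw [abs_le]; constructor <;> linarith
  have hsl : 1 / 2 ≤ √(P ^ 2 + (Q + e) ^ 2) := by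
    apply Real.le_sqrt_of_sq_le; linarith
  have hsu : √(P ^ 2 + (Q + e) ^ 2) ≤ 2 := by
    apply Real.sqrt_le_iff.2; constructor <;> linarith
  obtain ⟨h1, h2⟩ := abs_div_le_of_bounds hM hQE hD hC hsl
  refine ⟨hlow, ?_, h1, h2⟩
  rw [abs_of_nonneg (Real.sqrt_nonneg _)]
  nlinarith

/-! ### Algebra in the left-invariant frame -/

lemma fderiv_apply_eq_frame (f : Heis → ℝ) (g v : Heis) :
    fderiv ℝ f g v = frameCoord g v 0 * along X1 f g + frameCoord g v 1 * along X2 f g +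
      frameCoord g v 2 * along T f g := by
  conv_lhs => rw [← frameCoord_spec g v]
  simp only [map_add, map_smul, smul_eq_mul, along]

/-- The frame coordinates at `g`, as a linear map. -/
def frameLinear (g : Heis) : Heis →ₗ[ℝ] (Fin 3 → ℝ) where
  toFun := frameCoord g
  map_add' v w := by
    ext i; fin_cases i <;> simp [frameCoord]; ring
  map_smul' c v := by
    ext i; fin_cases i <;> simp [frameCoord]; ring

@[simp] lemma frameLinear_apply (g v : Heis) : frameLinear g v = frameCoord g v := rfl

lemma frameLinear_injective (g : Heis) : Function.Injective (frameLinear g) := by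
  intro v w h
  rw [← frameCoord_spec g v, ← frameCoord_spec g w]
  simp only [frameLinear_apply] at h
  rw [h]

lemma patchNormal_zero (θ : ℝ × ℝ → Heis) (u : ℝ × ℝ) :
    patchNormal θ u 0 =
      frameCoord (θ u) (fderiv ℝ θ u (1, 0)) 1 * frameCoord (θ u) (fderiv ℝ θ u (0, 1)) 2 -
      frameCoord (θ u) (fderiv ℝ θ u (1, 0)) 2 * frameCoord (θ u) (fderiv ℝ θ u (0, 1)) 1 := by
  simp [patchNormal, cross_apply]

lemma patchNormal_one (θ : ℝ × ℝ → Heis) (u : ℝ × ℝ) :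
    patchNormal θ u 1 =
      frameCoord (θ u) (fderiv ℝ θ u (1, 0)) 2 * frameCoord (θ u) (fderiv ℝ θ u (0, 1)) 0 -
      frameCoord (θ u) (fderiv ℝ θ u (1, 0)) 0 * frameCoord (θ u) (fderiv ℝ θ u (0, 1)) 2 := by
  simp [patchNormal, cross_apply]

lemma patchNormal_two (θ : ℝ × ℝ → Heis) (u : ℝ × ℝ) :
    patchNormal θ u 2 =
      frameCoord (θ u) (fderiv ℝ θ u (1, 0)) 0 * frameCoord (θ u) (fderiv ℝ θ u (0, 1)) 1 -
      frameCoord (θ u) (fderiv ℝ θ u (1, 0)) 1 * frameCoord (θ u) (fderiv ℝ θ u (0, 1)) 0 := by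
  simp [patchNormal, cross_apply]

lemma patchNormal_ne_zero {θ : ℝ × ℝ → Heis} {u : ℝ × ℝ}
    (h : Function.Injective (fderiv ℝ θ u)) : patchNormal θ u ≠ 0 := by
  rw [patchNormal, crossProduct_ne_zero_iff_linearIndependent]
  have h1 : LinearIndependent ℝ ![((1, 0) : ℝ × ℝ), (0, 1)] := by
    rw [LinearIndependent.pair_iff]
    intro s t hst
    simpa [Prod.ext_iff] using hst
  have h2 := h1.map' ((frameLinear (θ u)).comp (fderiv ℝ θ u : ℝ × ℝ →ₗ[ℝ] Heis))
    (LinearMap.ker_eq_bot.2 ((frameLinear_injective _).comp h))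
  have e : ![frameCoord (θ u) (fderiv ℝ θ u (1, 0)), frameCoord (θ u) (fderiv ℝ θ u (0, 1))] =
      ((frameLinear (θ u)).comp (fderiv ℝ θ u : ℝ × ℝ →ₗ[ℝ] Heis)) ∘
        ![((1, 0) : ℝ × ℝ), (0, 1)] := by
    ext i j
    fin_cases i <;> rfl
  rw [e]
  exact h2

/-- In dimension three the vectors orthogonal to both `a` and `b` include `a ⨯₃ b`; the factor is
the projection coefficient `⟨n, a ⨯₃ b⟩ / |n|²`. -/
lemma cross_eq_smul {n a b : Fin 3 → ℝ} (ha : n 0 * a 0 + n 1 * a 1 + n 2 * a 2 = 0)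
    (hb : n 0 * b 0 + n 1 * b 1 + n 2 * b 2 = 0) (hn : n ≠ 0) : ∃ c : ℝ, a ⨯₃ b = c • n := by
  have hn2 : n 0 ^ 2 + n 1 ^ 2 + n 2 ^ 2 ≠ 0 := by
    intro h
    apply hn
    have h0 : n 0 = 0 := by nlinarith [sq_nonneg (n 0), sq_nonneg (n 1), sq_nonneg (n 2)]
    have h1 : n 1 = 0 := by nlinarith [sq_nonneg (n 0), sq_nonneg (n 1), sq_nonneg (n 2)]
    have h2 : n 2 = 0 := by nlinarith [sq_nonneg (n 0), sq_nonneg (n 1), sq_nonneg (n 2)]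
    ext i; fin_cases i <;> assumption
  refine ⟨(n 0 * (a 1 * b 2 - a 2 * b 1) + n 1 * (a 2 * b 0 - a 0 * b 2) +
    n 2 * (a 0 * b 1 - a 1 * b 0)) / (n 0 ^ 2 + n 1 ^ 2 + n 2 ^ 2), ?_⟩
  ext i
  rw [Pi.smul_apply, smul_eq_mul, div_mul_eq_mul_div, eq_div_iff hn2]
  fin_cases i <;> simp [cross_apply]
  · linear_combination (b 0 * 0 + n 1 * b 2 - n 2 * b 1) * ha - (n 1 * a 2 - n 2 * a 1) * hb
  · linear_combination (n 2 * b 0 - n 0 * b 2) * ha - (n 2 * a 0 - n 0 * a 2) * hb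
  · linear_combination (n 0 * b 1 - n 1 * b 0) * ha - (n 0 * a 1 - n 1 * a 0) * hb

/-- The normal of a parametrization is parallel to the gradient of a function which vanishes on
its image. -/
lemma patchNormal_eq_smul_rgrad {θ : ℝ × ℝ → Heis} {u : ℝ × ℝ} {f : Heis → ℝ}
    (hθ : DifferentiableAt ℝ θ u) (hinj : Function.Injective (fderiv ℝ θ u))
    (hf : DifferentiableAt ℝ f (θ u)) (hn : rgrad f (θ u) ≠ 0)
    (h0 : ∀ᶠ w in 𝓝 u, f (θ w) = 0) :
    ∃ c : ℝ, c ≠ 0 ∧ patchNormal θ u = c • rgrad f (θ u) := by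
  have hd : ∀ v, fderiv ℝ f (θ u) (fderiv ℝ θ u v) = 0 := by
    intro v
    have h1 : fderiv ℝ (f ∘ θ) u = (fderiv ℝ f (θ u)).comp (fderiv ℝ θ u) := fderiv_comp u hf hθ
    have h2 : f ∘ θ =ᶠ[𝓝 u] fun _ => 0 := h0
    rw [h2.fderiv_eq] at h1
    have := congrArg (fun A => A v) h1
    simpa using this.symm
  have key : ∀ v, rgrad f (θ u) 0 * frameCoord (θ u) (fderiv ℝ θ u v) 0 +
      rgrad f (θ u) 1 * frameCoord (θ u) (fderiv ℝ θ u v) 1 +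
      rgrad f (θ u) 2 * frameCoord (θ u) (fderiv ℝ θ u v) 2 = 0 := by
    intro v
    have := hd v
    rw [fderiv_apply_eq_frame] at this
    simp only [rgrad, Matrix.cons_val_zero, Matrix.cons_val_one, Matrix.cons_val]
    linarith
  obtain ⟨c, hc⟩ := cross_eq_smul (key (1, 0)) (key (0, 1)) hn
  refine ⟨c, ?_, hc⟩
  rintro rfl
  exact patchNormal_ne_zero hinj (by rw [patchNormal, hc, zero_smul])

lemma det_prod_eq (A : ℝ × ℝ →L[ℝ] ℝ × ℝ) :
    A.det = (A (1, 0)).1 * (A (0, 1)).2 - (A (0, 1)).1 * (A (1, 0)).2 := by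
  rw [ContinuousLinearMap.det, ← LinearMap.det_toMatrix (Module.Basis.finTwoProd ℝ),
    Matrix.det_fin_two]
  simp [LinearMap.toMatrix_apply]

/-- The change of the normal under a change of parameters. -/
lemma patchNormal_comp {θ θ' : ℝ × ℝ → Heis} {ψ : ℝ × ℝ → ℝ × ℝ} {u : ℝ × ℝ}
    (hθ : DifferentiableAt ℝ θ (ψ u)) (hψ : DifferentiableAt ℝ ψ u)
    (h : θ' =ᶠ[𝓝 u] θ ∘ ψ) :
    patchNormal θ' u = (fderiv ℝ ψ u).det • patchNormal θ (ψ u) := by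
  have h1 : fderiv ℝ θ' u = (fderiv ℝ θ (ψ u)).comp (fderiv ℝ ψ u) := by
    rw [h.fderiv_eq]; exact fderiv_comp u hθ hψ
  have h2 : θ' u = θ (ψ u) := h.self_of_nhds
  have h3 : ∀ v, frameCoord (θ' u) (fderiv ℝ θ' u v) =
      (fderiv ℝ ψ u v).1 • frameCoord (θ (ψ u)) (fderiv ℝ θ (ψ u) (1, 0)) +
      (fderiv ℝ ψ u v).2 • frameCoord (θ (ψ u)) (fderiv ℝ θ (ψ u) (0, 1)) := by
    intro v
    have : fderiv ℝ ψ u v = (fderiv ℝ ψ u v).1 • ((1, 0) : ℝ × ℝ) +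
        (fderiv ℝ ψ u v).2 • ((0, 1) : ℝ × ℝ) := by ext <;> simp
    rw [h2, h1, ContinuousLinearMap.comp_apply]
    conv_lhs => rw [this]
    simp only [map_add, map_smul, ← frameLinear_apply]
  rw [patchNormal, h3, h3, det_prod_eq, patchNormal]
  ext i
  fin_cases i <;> simp [cross_apply] <;> ring

/-- The density of the horizontal perimeter in a parametrization. -/
def density (θ : ℝ × ℝ → Heis) (u : ℝ × ℝ) : ℝ :=
  √(patchNormal θ u 0 ^ 2 + patchNormal θ u 1 ^ 2)

/-- The cross product of two combinations of two vectors is their cross product times the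
determinant. The factor is the Jacobian of the change of variables formula, so overlapping
parametrizations give the same perimeter. -/
lemma density_comp {θ θ' : ℝ × ℝ → Heis} {ψ : ℝ × ℝ → ℝ × ℝ} {u : ℝ × ℝ}
    (hθ : DifferentiableAt ℝ θ (ψ u)) (hψ : DifferentiableAt ℝ ψ u)
    (h : θ' =ᶠ[𝓝 u] θ ∘ ψ) :
    density θ' u = |(fderiv ℝ ψ u).det| * density θ (ψ u) := by
  rw [density, patchNormal_comp hθ hψ h, density, ← Real.sqrt_sq_eq_abs,
    ← Real.sqrt_mul (sq_nonneg _)]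
  simp only [Pi.smul_apply, smul_eq_mul]
  congr 1
  ring

lemma density_eq_of_smul {θ : ℝ × ℝ → Heis} {u : ℝ × ℝ} {f : Heis → ℝ} {c : ℝ}
    (h : patchNormal θ u = c • rgrad f (θ u)) : density θ u = |c| * W f (θ u) := by
  rw [density, h, W, ← Real.sqrt_sq_eq_abs, ← Real.sqrt_mul (sq_nonneg _)]
  simp only [Pi.smul_apply, smul_eq_mul, rgrad, Matrix.cons_val_zero, Matrix.cons_val_one]
  congr 1
  ring

/-! ### Deformations along `X₁` -/

lemma fderiv_deform_apply {b : Heis → ℝ} {g : Heis} (hb : DifferentiableAt ℝ b g) (r : ℝ)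
    (v : Heis) :
    fderiv ℝ (deform (fun g => b g • X1 g) r) g v =
      v + r • (fderiv ℝ b g v • X1 g + b g • ((0, 0, -(v.2.1 / 2)) : Heis)) := by
  have hX : HasFDerivAt X1 ((0 : Heis →L[ℝ] ℝ).prod ((0 : Heis →L[ℝ] ℝ).prod
      (-((1 / 2 : ℝ) • (ContinuousLinearMap.fst ℝ ℝ ℝ).comp
        (ContinuousLinearMap.snd ℝ ℝ (ℝ × ℝ)))))) g := by
    refine HasFDerivAt.prodMk (hasFDerivAt_const _ _) (HasFDerivAt.prodMk (hasFDerivAt_const _ _) ?_)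
    have := (((ContinuousLinearMap.fst ℝ ℝ ℝ).comp
        (ContinuousLinearMap.snd ℝ ℝ (ℝ × ℝ))).hasFDerivAt (x := g)).const_smul (1 / 2 : ℝ)
    refine (this.neg).congr_of_eventuallyEq (Eventually.of_forall fun h => ?_)
    simp; ring
  have h1 := ((hasFDerivAt_id g).add ((hb.hasFDerivAt.smul hX).const_smul r))
  have h2 : HasFDerivAt (deform (fun g => b g • X1 g) r) _ g := h1
  rw [h2.fderiv]
  simp only [_root_.add_apply, _root_.smul_apply,
    ContinuousLinearMap.smulRight_apply, ContinuousLinearMap.id_apply]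
  congr 2
  rw [add_comm]
  congr 2
  ext <;> simp; ring

/-- Moving by `r b X₁` is right translation by `(r b, 0, 0)` with varying `b`. Variation of `b` only
adds an `X₁` component, while `[X₁, X₂] = T` makes the `X₂` component of `v` contribute to the `T`
component. -/
lemma frameCoord_deform {b : Heis → ℝ} {g : Heis} (hb : DifferentiableAt ℝ b g) (r : ℝ)
    (v : Heis) :
    frameCoord (deform (fun g => b g • X1 g) r g)
      (fderiv ℝ (deform (fun g => b g • X1 g) r) g v) =
      ![frameCoord g v 0 + r * (frameCoord g v 0 * along X1 b g +
          frameCoord g v 1 * along X2 b g + frameCoord g v 2 * along T b g),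
        frameCoord g v 1, frameCoord g v 2 - r * b g * frameCoord g v 1] := by
  rw [fderiv_deform_apply hb, ← fderiv_apply_eq_frame b g v]
  ext i
  fin_cases i <;> simp [frameCoord, deform, X1]
  ring

/-- The horizontal components of the normal of a deformed parametrization. -/
lemma patchNormal_deform {b : Heis → ℝ} {r : ℝ} {θ : ℝ × ℝ → Heis} {u : ℝ × ℝ}
    (hb : DifferentiableAt ℝ b (θ u)) (hθ : DifferentiableAt ℝ θ u)
    (hΦ : DifferentiableAt ℝ (deform (fun g => b g • X1 g) r) (θ u)) :
    patchNormal (deform (fun g => b g • X1 g) r ∘ θ) u 0 = patchNormal θ u 0 ∧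
    patchNormal (deform (fun g => b g • X1 g) r ∘ θ) u 1 = patchNormal θ u 1 +
      r * (along X1 b (θ u) * patchNormal θ u 1 - along X2 b (θ u) * patchNormal θ u 0 +
        b (θ u) * patchNormal θ u 2) +
      r ^ 2 * (b (θ u) * (along X1 b (θ u) * patchNormal θ u 2 -
        along T b (θ u) * patchNormal θ u 0)) := by
  have h : ∀ v, fderiv ℝ (deform (fun g => b g • X1 g) r ∘ θ) u v =
      fderiv ℝ (deform (fun g => b g • X1 g) r) (θ u) (fderiv ℝ θ u v) := fun v => by
    rw [fderiv_comp u hΦ hθ]; rfl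
  simp only [patchNormal_zero, patchNormal_one, patchNormal_two, h, Function.comp_apply,
    frameCoord_deform hb]
  simp only [Matrix.cons_val_zero, Matrix.cons_val_one, Matrix.cons_val]
  constructor <;> ring

/-! ### The perimeter measure -/

lemma measurableSet_inter_preimage {α β : Type*} [TopologicalSpace α] [MeasurableSpace α]
    [BorelSpace α] [TopologicalSpace β] [MeasurableSpace β] [BorelSpace β] {U : Set α} {f : α → β}
    (hf : ContinuousOn f U) (hU : MeasurableSet U) {A : Set β} (hA : MeasurableSet A) :
    MeasurableSet (U ∩ f ⁻¹' A) := by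
  have : U ∩ f ⁻¹' A = Subtype.val '' (U.domRestrict f ⁻¹' A) := by
    ext u
    constructor
    · rintro ⟨h1, h2⟩
      exact ⟨⟨u, h1⟩, h2, rfl⟩
    · rintro ⟨u, h, rfl⟩
      exact ⟨u.2, h⟩
  rw [this]
  exact hU.subtype_image ((continuousOn_iff_continuous_domRestrict.1 hf).measurable hA)

lemma IsPatch.differentiableAt {M : Set Heis} {U : Set (ℝ × ℝ)} {θ : ℝ × ℝ → Heis}
    (h : IsPatch M U θ) {u : ℝ × ℝ} (hu : u ∈ U) : DifferentiableAt ℝ θ u :=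
  (h.contDiffOn.contDiffAt (h.isOpen.mem_nhds hu)).differentiableAt one_ne_zero

lemma IsPatch.continuousOn {M : Set Heis} {U : Set (ℝ × ℝ)} {θ : ℝ × ℝ → Heis}
    (h : IsPatch M U θ) : ContinuousOn θ U := h.contDiffOn.continuousOn

lemma continuousOn_frameCoord_fderiv {U : Set (ℝ × ℝ)} {θ : ℝ × ℝ → Heis} (hU : IsOpen U)
    (h : ContDiffOn ℝ 1 θ U) (v : ℝ × ℝ) (i : Fin 3) :
    ContinuousOn (fun u => frameCoord (θ u) (fderiv ℝ θ u v) i) U := by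
  have h1 : ContinuousOn (fun u => fderiv ℝ θ u v) U :=
    (h.continuousOn_fderiv_of_isOpen hU le_rfl).clm_apply continuousOn_const
  have h2 := h.continuousOn
  have h11 : ContinuousOn (fun u => (fderiv ℝ θ u v).1) U := continuous_fst.comp_continuousOn h1
  have h12 : ContinuousOn (fun u => (fderiv ℝ θ u v).2.1) U :=
    (continuous_fst.comp continuous_snd).comp_continuousOn h1
  have h13 : ContinuousOn (fun u => (fderiv ℝ θ u v).2.2) U :=
    (continuous_snd.comp continuous_snd).comp_continuousOn h1
  have h21 : ContinuousOn (fun u => (θ u).1) U := continuous_fst.comp_continuousOn h2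
  have h22 : ContinuousOn (fun u => (θ u).2.1) U :=
    (continuous_fst.comp continuous_snd).comp_continuousOn h2
  fin_cases i
  · exact h11
  · exact h12
  · exact (h13.add ((h22.div_const 2).mul h11)).sub ((h21.div_const 2).mul h12)

lemma continuousOn_density {U : Set (ℝ × ℝ)} {θ : ℝ × ℝ → Heis} (hU : IsOpen U)
    (h : ContDiffOn ℝ 1 θ U) : ContinuousOn (density θ) U := by
  have hc := continuousOn_frameCoord_fderiv hU h
  unfold density
  simp only [patchNormal_zero, patchNormal_one]
  exact (((((hc _ _).mul (hc _ _)).sub ((hc _ _).mul (hc _ _))).pow 2).add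
    ((((hc _ _).mul (hc _ _)).sub ((hc _ _).mul (hc _ _))).pow 2)).sqrt

lemma patchPerimeter_eq (U : Set (ℝ × ℝ)) (θ : ℝ × ℝ → Heis) :
    patchPerimeter U θ = Measure.map θ ((volume.restrict U).withDensity fun u =>
      ENNReal.ofReal (density θ u)) := rfl

lemma aemeasurable_withDensity {U : Set (ℝ × ℝ)} {θ : ℝ × ℝ → Heis} (hU : IsOpen U)
    (h : ContinuousOn θ U) (d : ℝ × ℝ → ENNReal) :
    AEMeasurable θ ((volume.restrict U).withDensity d) :=
  (h.aemeasurable hU.measurableSet).mono_ac (withDensity_absolutelyContinuous _ _)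

lemma patchPerimeter_apply {U : Set (ℝ × ℝ)} {θ : ℝ × ℝ → Heis} (hU : IsOpen U)
    (h : ContinuousOn θ U) {A : Set Heis} (hA : MeasurableSet A) :
    patchPerimeter U θ A = ∫⁻ u in U ∩ θ ⁻¹' A, ENNReal.ofReal (density θ u) := by
  rw [patchPerimeter_eq, Measure.map_apply_of_aemeasurable (aemeasurable_withDensity hU h _) hA,
    withDensity_apply', Measure.restrict_restrict' hU.measurableSet, Set.inter_comm]

lemma patchPerimeter_le_perimeter {M : Set Heis} {U : Set (ℝ × ℝ)} {θ : ℝ × ℝ → Heis}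
    (h : IsPatch M U θ) : patchPerimeter U θ ≤ perimeter M :=
  le_iSup (fun P : {P : Set (ℝ × ℝ) × (ℝ × ℝ → Heis) // IsPatch M P.1 P.2} =>
    patchPerimeter P.1.1 P.1.2) ⟨(U, θ), h⟩

lemma perimeter_le {M : Set Heis} {ν : Measure Heis}
    (h : ∀ U θ, IsPatch M U θ → patchPerimeter U θ ≤ ν) : perimeter M ≤ ν :=
  iSup_le fun P => h _ _ P.2

lemma perimeter_restrict_self {M : Set Heis} (hM : MeasurableSet M) :
    (perimeter M).restrict M = perimeter M := by
  refine le_antisymm Measure.restrict_le_self (perimeter_le fun U θ h => ?_)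
  refine Measure.le_iff.2 fun A hA => ?_
  rw [Measure.restrict_apply hA]
  refine le_trans ?_ (patchPerimeter_le_perimeter h _)
  rw [patchPerimeter_apply h.isOpen h.continuousOn hA,
    patchPerimeter_apply h.isOpen h.continuousOn (hA.inter hM)]
  refine lintegral_mono_set fun u hu => ⟨hu.1, hu.2, h.mapsTo hu.1⟩

/-- On the domain of a chart the perimeter measure is computed in the chart. -/
lemma perimeter_restrict_chart {M O : Set Heis} {U : Set (ℝ × ℝ)} {θ : ℝ × ℝ → Heis}
    {π : Heis → ℝ × ℝ} (hO : IsOpen O) (hθ : IsPatch M U θ) (hθO : Set.MapsTo θ U O)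
    (hπ : ContDiff ℝ 1 π) (hinv : ∀ g ∈ M ∩ O, π g ∈ U ∧ θ (π g) = g) :
    (perimeter M).restrict O = patchPerimeter U θ := by
  apply le_antisymm
  -- Inside `O` any other parametrization factors as `θ ∘ (π ∘ θ')`. The transition map `π ∘ θ'` is
  -- injective there, so the change of variables formula carries one density to the other.
  · have key : ∀ U' θ', IsPatch M U' θ' → (patchPerimeter U' θ').restrict O ≤
        patchPerimeter U θ := by
      intro U' θ' h'
      refine Measure.le_iff.2 fun A hA => ?_
      rw [Measure.restrict_apply hA, patchPerimeter_apply hθ.isOpen hθ.continuousOn hA,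
        patchPerimeter_apply h'.isOpen h'.continuousOn (hA.inter hO.measurableSet)]
      have hopen : IsOpen (U' ∩ θ' ⁻¹' O) := h'.continuousOn.isOpen_inter_preimage h'.isOpen hO
      have hmeas : MeasurableSet (U' ∩ θ' ⁻¹' (A ∩ O)) :=
        measurableSet_inter_preimage h'.continuousOn h'.isOpen.measurableSet
          (hA.inter hO.measurableSet)
      have hψ : ∀ u ∈ U' ∩ θ' ⁻¹' O, DifferentiableAt ℝ (π ∘ θ') u := fun u hu =>
        (hπ.differentiable one_ne_zero _).comp u (h'.differentiableAt hu.1)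
      have hloc : ∀ u ∈ U' ∩ θ' ⁻¹' O, π (θ' u) ∈ U ∧ θ (π (θ' u)) = θ' u := fun u hu =>
        hinv _ ⟨h'.mapsTo hu.1, hu.2⟩
      have hsub : U' ∩ θ' ⁻¹' (A ∩ O) ⊆ U' ∩ θ' ⁻¹' O := fun u hu => ⟨hu.1, hu.2.2⟩
      have hd : ∀ u ∈ U' ∩ θ' ⁻¹' O, density θ' u =
          |(fderiv ℝ (π ∘ θ') u).det| * density θ ((π ∘ θ') u) := by
        intro u hu
        refine density_comp (hθ.differentiableAt (hloc u hu).1) (hψ u hu) ?_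
        filter_upwards [hopen.mem_nhds hu] with w hw using (hloc w hw).2.symm
      calc ∫⁻ u in U' ∩ θ' ⁻¹' (A ∩ O), ENNReal.ofReal (density θ' u)
          = ∫⁻ u in U' ∩ θ' ⁻¹' (A ∩ O), ENNReal.ofReal |(fderiv ℝ (π ∘ θ') u).det| *
              ENNReal.ofReal (density θ ((π ∘ θ') u)) := by
            refine setLIntegral_congr_fun hmeas fun u hu => ?_
            rw [hd u (hsub hu), ENNReal.ofReal_mul (abs_nonneg _)]
        _ = ∫⁻ u in (π ∘ θ') '' (U' ∩ θ' ⁻¹' (A ∩ O)), ENNReal.ofReal (density θ u) := by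
            rw [lintegral_image_eq_lintegral_abs_det_fderiv_mul volume hmeas
              (fun u hu => (hψ u (hsub hu)).hasFDerivAt.hasFDerivWithinAt)]
            intro u hu w hw huw
            apply h'.injOn hu.1 hw.1
            rw [← (hloc u (hsub hu)).2, ← (hloc w (hsub hw)).2]
            exact congrArg θ huw
        _ ≤ _ := by
            refine lintegral_mono_set ?_
            rintro _ ⟨u, hu, rfl⟩
            refine ⟨(hloc u (hsub hu)).1, ?_⟩
            simp only [Set.mem_preimage, Function.comp_apply, (hloc u (hsub hu)).2]
            exact hu.2.1
    -- The perimeter is a supremum of measures, so an upper bound has to dominate each parametrized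
    -- piece on the whole space. The summand living off `O` achieves this and disappears on
    -- restriction to `O`.
    have h1 : perimeter M ≤ patchPerimeter U θ + (perimeter M).restrict Oᶜ := by
      refine perimeter_le fun U' θ' h' => ?_
      rw [← Measure.restrict_add_restrict_compl (μ := patchPerimeter U' θ') hO.measurableSet]
      exact add_le_add (key U' θ' h')
        (Measure.restrict_mono le_rfl (patchPerimeter_le_perimeter h'))
    calc (perimeter M).restrict O
        ≤ (patchPerimeter U θ + (perimeter M).restrict Oᶜ).restrict O :=
          Measure.restrict_mono le_rfl h1
      _ = (patchPerimeter U θ).restrict O := by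
          rw [Measure.restrict_add, Measure.restrict_restrict hO.measurableSet,
            Set.inter_compl_self, Measure.restrict_empty, add_zero]
      _ ≤ patchPerimeter U θ := Measure.restrict_le_self
  · refine Measure.le_iff.2 fun A hA => ?_
    rw [Measure.restrict_apply hA]
    refine le_trans ?_ (patchPerimeter_le_perimeter hθ _)
    rw [patchPerimeter_apply hθ.isOpen hθ.continuousOn hA,
      patchPerimeter_apply hθ.isOpen hθ.continuousOn (hA.inter hO.measurableSet)]
    exact lintegral_mono_set fun u hu => ⟨hu.1, hu.2, hθO hu.1⟩

/-- Integrals against the perimeter of a parametrized piece. -/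
lemma integral_patchPerimeter {U : Set (ℝ × ℝ)} {θ : ℝ × ℝ → Heis} (hU : IsOpen U)
    (h : ContDiffOn ℝ 1 θ U) {f : Heis → ℝ} (hf : AEStronglyMeasurable f (patchPerimeter U θ)) :
    ∫ g, f g ∂(patchPerimeter U θ) = ∫ u in U, density θ u * f (θ u) := by
  rw [patchPerimeter_eq] at hf ⊢
  rw [integral_map (aemeasurable_withDensity hU h.continuousOn _) hf,
    integral_withDensity_eq_integral_toReal_smul₀ _ (by simp)]
  · simp only [smul_eq_mul]
    refine integral_congr_ae (Eventually.of_forall fun u => ?_)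
    simp only
    rw [ENNReal.toReal_ofReal (show 0 ≤ density θ u from Real.sqrt_nonneg _)]
  · exact ((continuousOn_density hU h).aemeasurable hU.measurableSet).ennreal_ofReal

lemma withDensity_mono_left {α : Type*} [MeasurableSpace α] {μ ν : Measure α} (h : μ ≤ ν)
    (f : α → ENNReal) : μ.withDensity f ≤ ν.withDensity f :=
  Measure.le_iff.2 fun A hA => by
    rw [withDensity_apply _ hA, withDensity_apply _ hA]
    exact lintegral_mono' (Measure.restrict_mono le_rfl h) le_rfl

lemma IsPatch.comp {M : Set Heis} {U : Set (ℝ × ℝ)} {θ : ℝ × ℝ → Heis} (h : IsPatch M U θ)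
    (Φ : Heis ≃ₜ Heis) (hΦ : ContDiff ℝ 1 Φ) (hΦ' : ContDiff ℝ 1 Φ.symm) :
    IsPatch (Φ '' M) U (Φ ∘ θ) where
  isOpen := h.isOpen
  contDiffOn := hΦ.comp_contDiffOn h.contDiffOn
  injOn := Φ.injective.comp_injOn h.injOn
  immersion u hu := by
    have h1 : fderiv ℝ (Φ ∘ θ) u = (fderiv ℝ Φ (θ u)).comp (fderiv ℝ θ u) :=
      fderiv_comp u (hΦ.differentiable one_ne_zero _) (h.differentiableAt hu)
    have h2 : (fderiv ℝ Φ.symm (Φ (θ u))).comp (fderiv ℝ Φ (θ u)) =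
        ContinuousLinearMap.id ℝ Heis := by
      rw [← fderiv_comp _ (hΦ'.differentiable one_ne_zero _) (hΦ.differentiable one_ne_zero _)]
      have : (Φ.symm ∘ Φ) = id := by ext1 x; simp
      rw [this, fderiv_id]
    rw [h1]
    refine Function.Injective.comp (g := fderiv ℝ Φ (θ u)) ?_ (h.immersion u hu)
    refine Function.LeftInverse.injective (g := fderiv ℝ Φ.symm (Φ (θ u))) fun v => ?_
    exact congrArg (fun A => A v) h2
  mapsTo u hu := ⟨θ u, h.mapsTo hu, rfl⟩

/-- The transformation of the perimeter measure under a diffeomorphism which multiplies the density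
of every parametrization of the surface by `j`. -/
lemma perimeter_image {M : Set Heis} (Φ : Heis ≃ₜ Heis) (hΦ : ContDiff ℝ 1 Φ)
    (hΦ' : ContDiff ℝ 1 Φ.symm) {j : Heis → ℝ} (hj : Measurable j) (hj0 : ∀ g, 0 < j g)
    (hd : ∀ U θ, IsPatch M U θ → ∀ u ∈ U, density (Φ ∘ θ) u = j (θ u) * density θ u) :
    perimeter (Φ '' M) =
      ((perimeter M).withDensity fun g => ENNReal.ofReal (j g)).map Φ := by
  have key : ∀ U θ, IsPatch M U θ → patchPerimeter U (Φ ∘ θ) =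
      ((patchPerimeter U θ).withDensity fun g => ENNReal.ofReal (j g)).map Φ := by
    intro U θ h
    have hm := aemeasurable_withDensity h.isOpen h.continuousOn
      fun u => ENNReal.ofReal (density θ u)
    refine Measure.ext fun A hA => ?_
    have hA' := Φ.continuous.measurable hA
    rw [patchPerimeter_apply h.isOpen (Φ.continuous.comp_continuousOn h.continuousOn) hA,
      Measure.map_apply Φ.continuous.measurable hA, withDensity_apply _ hA',
      ← lintegral_indicator hA', patchPerimeter_eq,
      lintegral_map' ((hj.ennreal_ofReal.indicator hA').aemeasurable) hm,
      lintegral_withDensity_eq_lintegral_mul_non_measurable₀ _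
        ((continuousOn_density h.isOpen h.contDiffOn).aemeasurable
          h.isOpen.measurableSet).ennreal_ofReal (by simp)]
    have hmeas : MeasurableSet (U ∩ (Φ ∘ θ) ⁻¹' A) :=
      measurableSet_inter_preimage (Φ.continuous.comp_continuousOn h.continuousOn)
        h.isOpen.measurableSet hA
    rw [← lintegral_indicator hmeas, ← lintegral_indicator h.isOpen.measurableSet]
    refine lintegral_congr fun u => ?_
    by_cases hu : u ∈ U
    · by_cases hA : Φ (θ u) ∈ A
      · have hA2 : θ u ∈ Φ ⁻¹' A := hA
        rw [Set.indicator_of_mem (show u ∈ U ∩ (Φ ∘ θ) ⁻¹' A from ⟨hu, hA⟩),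
          Set.indicator_of_mem hu, Pi.mul_apply, Set.indicator_of_mem hA2, hd U θ h u hu,
          ENNReal.ofReal_mul (hj0 _).le, mul_comm]
      · have hA2 : θ u ∉ Φ ⁻¹' A := hA
        rw [Set.indicator_of_notMem (fun h : u ∈ U ∩ (Φ ∘ θ) ⁻¹' A => hA h.2),
          Set.indicator_of_mem hu, Pi.mul_apply, Set.indicator_of_notMem hA2, mul_zero]
    · rw [Set.indicator_of_notMem hu,
        Set.indicator_of_notMem (fun h : u ∈ U ∩ (Φ ∘ θ) ⁻¹' A => hu h.1)]
  apply le_antisymm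
  · refine perimeter_le fun U θ h => ?_
    -- Every parametrization of the image is `Φ` composed with one of `M`.
    have h1 : IsPatch M U (Φ.symm ∘ θ) := by
      have := h.comp Φ.symm hΦ' hΦ
      rwa [Φ.symm.image_eq_preimage_symm, Homeomorph.symm_symm,
        Set.preimage_image_eq _ Φ.injective] at this
    have h2 : Φ ∘ (Φ.symm ∘ θ) = θ := by ext1 u; simp
    have h3 := key U _ h1
    rw [h2] at h3
    rw [h3]
    exact Measure.map_mono (withDensity_mono_left (patchPerimeter_le_perimeter h1) _)
      Φ.continuous.measurable
  -- For the other inequality both operations are undone: multiplication by `j` is inverted since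
  -- `j` is positive and finite, and push-forward by `Φ` since `Φ` is a homeomorphism. The bound
  -- then reduces again to one on each piece of `M`.
  · have h0 : ∀ μ : Measure Heis, ((μ.withDensity fun g => ENNReal.ofReal (j g)).withDensity
        fun g => (ENNReal.ofReal (j g))⁻¹) = μ := fun μ =>
      withDensity_inv_same hj.ennreal_ofReal
        (Eventually.of_forall fun g => by simpa using hj0 g) (by simp)
    have h0' : ∀ μ : Measure Heis, ((μ.withDensity fun g =>
        (ENNReal.ofReal (j g))⁻¹).withDensity fun g => ENNReal.ofReal (j g)) = μ := fun μ => by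
      have := withDensity_inv_same (μ := μ) (f := fun g => (ENNReal.ofReal (j g))⁻¹) hj.ennreal_ofReal.inv
        (Eventually.of_forall fun g => by simp)
        (Eventually.of_forall fun g => by simpa using hj0 g)
      simpa only [Pi.inv_apply, inv_inv] using this
    have hs : ∀ μ : Measure Heis, (μ.map Φ).map Φ.symm = μ := fun μ => by
      rw [Measure.map_map Φ.symm.continuous.measurable Φ.continuous.measurable]
      simp
    have hs' : ∀ μ : Measure Heis, (μ.map Φ.symm).map Φ = μ := fun μ => by
      rw [Measure.map_map Φ.continuous.measurable Φ.symm.continuous.measurable]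
      simp
    have h1 : perimeter M ≤ ((perimeter (Φ '' M)).map Φ.symm).withDensity
        fun g => (ENNReal.ofReal (j g))⁻¹ := by
      refine perimeter_le fun U θ h => ?_
      rw [← h0 (patchPerimeter U θ), ← hs ((patchPerimeter U θ).withDensity _), ← key U θ h]
      exact withDensity_mono_left (Measure.map_mono
        (patchPerimeter_le_perimeter (h.comp Φ hΦ hΦ')) Φ.symm.continuous.measurable) _
    have h2 := withDensity_mono_left h1 fun g => ENNReal.ofReal (j g)
    rw [h0'] at h2
    have h3 := Measure.map_mono h2 Φ.continuous.measurable
    rwa [hs'] at h3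

/-! ### Charts of an oriented surface -/

/-- A `C²` chart of `M` on the open set `O`, inverse to a linear projection `π`. -/
structure IsChart (M O : Set Heis) (U : Set (ℝ × ℝ)) (θ : ℝ × ℝ → Heis)
    (π : Heis →L[ℝ] ℝ × ℝ) : Prop where
  isOpen_nhd : IsOpen O
  isOpen : IsOpen U
  contDiffOn : ContDiffOn ℝ 2 θ U
  mapsTo : Set.MapsTo θ U M
  mapsTo_nhd : Set.MapsTo θ U O
  proj_apply : ∀ u ∈ U, π (θ u) = u
  inv : ∀ g ∈ M ∩ O, π g ∈ U ∧ θ (π g) = g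

namespace IsChart

variable {M O : Set Heis} {U : Set (ℝ × ℝ)} {θ : ℝ × ℝ → Heis} {π : Heis →L[ℝ] ℝ × ℝ}

lemma differentiableAt (h : IsChart M O U θ π) {u : ℝ × ℝ} (hu : u ∈ U) :
    DifferentiableAt ℝ θ u :=
  (h.contDiffOn.contDiffAt (h.isOpen.mem_nhds hu)).differentiableAt two_ne_zero

lemma proj_fderiv (h : IsChart M O U θ π) {u : ℝ × ℝ} (hu : u ∈ U) (v : ℝ × ℝ) :
    π (fderiv ℝ θ u v) = v := by
  have h1 : fderiv ℝ (π ∘ θ) u = π.comp (fderiv ℝ θ u) := by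
    rw [fderiv_comp u π.differentiableAt (h.differentiableAt hu), π.fderiv]
  have h2 : π ∘ θ =ᶠ[𝓝 u] id := by
    filter_upwards [h.isOpen.mem_nhds hu] with w hw using h.proj_apply w hw
  rw [h2.fderiv_eq, fderiv_id] at h1
  exact (congrArg (fun A => A v) h1).symm

lemma isPatch (h : IsChart M O U θ π) : IsPatch M U θ where
  isOpen := h.isOpen
  contDiffOn := h.contDiffOn.of_le one_le_two
  injOn u hu w hw huw := by rw [← h.proj_apply u hu, ← h.proj_apply w hw, huw]
  immersion _ hu := Function.LeftInverse.injective (g := π) (h.proj_fderiv hu)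
  mapsTo := h.mapsTo

lemma perimeter_restrict (h : IsChart M O U θ π) :
    (perimeter M).restrict O = patchPerimeter U θ :=
  perimeter_restrict_chart h.isOpen_nhd h.isPatch h.mapsTo_nhd π.contDiff h.inv

end IsChart

/-- A nonzero functional is nonzero on some coordinate vector, and `π` forgets that coordinate. Thus
`(L, π)` is injective, as the inverse function theorem will require. -/
lemma exists_proj {L : Heis →L[ℝ] ℝ} (hL : L ≠ 0) :
    ∃ π : Heis →L[ℝ] ℝ × ℝ, ∀ v, L v = 0 → π v = 0 → v = 0 := by
  have hdec : ∀ v : Heis, L v = v.1 * L (1, 0, 0) + v.2.1 * L (0, 1, 0) + v.2.2 * L (0, 0, 1) := by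
    intro v
    have : v = v.1 • ((1, 0, 0) : Heis) + v.2.1 • ((0, 1, 0) : Heis) +
        v.2.2 • ((0, 0, 1) : Heis) := by ext <;> simp
    conv_lhs => rw [this]
    simp only [map_add, map_smul, smul_eq_mul]
  by_cases h1 : L (1, 0, 0) = 0
  · by_cases h2 : L (0, 1, 0) = 0
    · have h3 : L (0, 0, 1) ≠ 0 := fun h3 => hL (ContinuousLinearMap.ext fun v => by
        rw [hdec v, h1, h2, h3]; simp)
      refine ⟨(ContinuousLinearMap.fst ℝ ℝ (ℝ × ℝ)).prod
        ((ContinuousLinearMap.fst ℝ ℝ ℝ).comp (ContinuousLinearMap.snd ℝ ℝ (ℝ × ℝ))), ?_⟩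
      rintro ⟨x, y, t⟩ hv hπ
      simp only [ContinuousLinearMap.prod_apply, ContinuousLinearMap.coe_fst',
        ContinuousLinearMap.comp_apply, ContinuousLinearMap.coe_snd', Prod.mk_eq_zero] at hπ
      obtain ⟨rfl, rfl⟩ : x = 0 ∧ y = 0 := hπ
      rw [hdec] at hv
      have hz : t = 0 := by simpa [h3] using hv
      rw [hz]
      rfl
    · refine ⟨(ContinuousLinearMap.fst ℝ ℝ (ℝ × ℝ)).prod
        ((ContinuousLinearMap.snd ℝ ℝ ℝ).comp (ContinuousLinearMap.snd ℝ ℝ (ℝ × ℝ))), ?_⟩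
      rintro ⟨x, y, t⟩ hv hπ
      simp only [ContinuousLinearMap.prod_apply, ContinuousLinearMap.coe_fst',
        ContinuousLinearMap.comp_apply, ContinuousLinearMap.coe_snd', Prod.mk_eq_zero] at hπ
      obtain ⟨rfl, rfl⟩ : x = 0 ∧ t = 0 := hπ
      rw [hdec] at hv
      have hz : y = 0 := by simpa [h2] using hv
      rw [hz]
      rfl
  · refine ⟨ContinuousLinearMap.snd ℝ ℝ (ℝ × ℝ), ?_⟩
    rintro ⟨x, y, t⟩ hv hπ
    simp only [ContinuousLinearMap.coe_snd', Prod.mk_eq_zero] at hπ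
    obtain ⟨rfl, rfl⟩ : y = 0 ∧ t = 0 := hπ
    rw [hdec] at hv
    have hz : x = 0 := by simpa [h1] using hv
    rw [hz]
    rfl

namespace OrientedC2Surface

variable (S : OrientedC2Surface)

lemma contDiffAt {g h : Heis} (hg : g ∈ S.carrier) (hh : h ∈ S.dom g) :
    ContDiffAt ℝ 2 (S.φ g) h :=
  (S.contDiffOn g hg).contDiffAt ((S.isOpen_dom g hg).mem_nhds hh)

lemma differentiableAt {g h : Heis} (hg : g ∈ S.carrier) (hh : h ∈ S.dom g) :
    DifferentiableAt ℝ (S.φ g) h :=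
  (S.contDiffAt hg hh).differentiableAt two_ne_zero

lemma fderiv_ne_zero {g h : Heis} (hg : g ∈ S.carrier) (hh : h ∈ S.dom g) :
    fderiv ℝ (S.φ g) h ≠ 0 := fun h0 => by
  apply S.rgrad_ne_zero g hg h hh
  ext i
  fin_cases i <;> simp [rgrad, along, h0]

lemma φ_eq_zero {g h : Heis} (hg : g ∈ S.carrier) (hh : h ∈ S.carrier) (hd : h ∈ S.dom g) :
    S.φ g h = 0 := by
  have : h ∈ S.carrier ∩ S.dom g := ⟨hh, hd⟩
  rw [S.inter_dom g hg] at this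
  exact this.2

lemma mem_carrier {g h : Heis} (hg : g ∈ S.carrier) (hd : h ∈ S.dom g) (h0 : S.φ g h = 0) :
    h ∈ S.carrier := by
  have : h ∈ {h ∈ S.dom g | S.φ g h = 0} := ⟨hd, h0⟩
  rw [← S.inter_dom g hg] at this
  exact this.1

/-- An oriented surface has `C²` charts around each of its points, with arbitrarily small
domains. -/
lemma exists_chart {g : Heis} (hg : g ∈ S.carrier) {V : Set Heis} (hV : V ∈ 𝓝 g) :
    ∃ O U θ π, IsChart S.carrier O U θ π ∧ g ∈ O ∧ O ⊆ S.dom g ∧ O ⊆ V ∧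
      ∀ v, fderiv ℝ (S.φ g) g v = 0 → π v = 0 → v = 0 := by
  obtain ⟨π, hπ⟩ := exists_proj (S.fderiv_ne_zero hg (S.mem_dom g hg))
  have hinj : Function.Injective ((fderiv ℝ (S.φ g) g).prod π : Heis →ₗ[ℝ] Heis) := by
    rw [← LinearMap.ker_eq_bot, LinearMap.ker_eq_bot']
    intro v hv
    have : (fderiv ℝ (S.φ g) g v, π v) = 0 := hv
    rw [Prod.mk_eq_zero] at this
    exact hπ v this.1 this.2
  let A : Heis ≃L[ℝ] Heis := (LinearEquiv.ofInjectiveEndo _ hinj).toContinuousLinearEquiv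
  have hA : (A : Heis →L[ℝ] Heis) = (fderiv ℝ (S.φ g) g).prod π := by ext <;> rfl
  -- This map flattens the surface to `{0} × ℝ²`; the chart is its local inverse restricted to that
  -- slice.
  let Ψ : Heis → Heis := fun h => (S.φ g h, π h)
  have hΨ : ContDiffAt ℝ 2 Ψ g :=
    (S.contDiffAt hg (S.mem_dom g hg)).prodMk π.contDiff.contDiffAt
  have hΨ' : HasFDerivAt Ψ (A : Heis →L[ℝ] Heis) g := by
    rw [hA]
    exact (S.differentiableAt hg (S.mem_dom g hg)).hasFDerivAt.prodMk π.hasFDerivAt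
  let e := hΨ.toOpenPartialHomeomorph Ψ hΨ' two_ne_zero
  have hee : ∀ h, e h = (S.φ g h, π h) := fun h => rfl
  have hge : g ∈ e.source := hΨ.mem_toOpenPartialHomeomorph_source hΨ' two_ne_zero
  have hsymm : ContDiffAt ℝ 2 e.symm (e g) := hΨ.to_localInverse hΨ' two_ne_zero
  -- The inverse function theorem gives regularity of the inverse at one point. Being `C²` at a
  -- point is an open condition, so the domain is shrunk to where it holds.
  obtain ⟨T', hT', hT'o, hgT'⟩ := eventually_nhds_iff.1 (hsymm.eventually (by simp))
  obtain ⟨V', hV'V, hV'o, hgV'⟩ := mem_nhds_iff.1 hV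
  have hO : IsOpen ((e.source ∩ e ⁻¹' T') ∩ (V' ∩ S.dom g)) :=
    (e.isOpen_inter_preimage hT'o).inter (hV'o.inter (S.isOpen_dom g hg))
  refine ⟨(e.source ∩ e ⁻¹' T') ∩ (V' ∩ S.dom g),
    (fun u : ℝ × ℝ => ((0 : ℝ), u)) ⁻¹' (e.target ∩ e.symm ⁻¹'
      ((e.source ∩ e ⁻¹' T') ∩ (V' ∩ S.dom g))), fun u => e.symm (0, u), π, ?_,
    ⟨⟨hge, hgT'⟩, hgV', S.mem_dom g hg⟩, fun h hh => hh.2.2, fun h hh => hV'V hh.2.1, hπ⟩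
  have hr : ∀ u : ℝ × ℝ, ((0 : ℝ), u) ∈ e.target → e (e.symm (0, u)) = (0, u) := fun u hu =>
    e.right_inv hu
  refine ⟨hO, (e.isOpen_inter_preimage_symm hO).preimage (by fun_prop), ?_, ?_, ?_, ?_, ?_⟩
  · intro u hu
    have h1 : ((0 : ℝ), u) ∈ T' := by
      have := hu.2.1.2
      rwa [Set.mem_preimage, hr u hu.1] at this
    have h2 : ContDiffAt ℝ 2 (fun u : ℝ × ℝ => ((0 : ℝ), u)) u :=
      (contDiff_const.prodMk contDiff_id).contDiffAt
    exact (ContDiffAt.comp u (hT' _ h1) h2).contDiffWithinAt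
  · intro u hu
    refine S.mem_carrier hg hu.2.2.2 ?_
    have := hr u hu.1
    rw [hee] at this
    exact (Prod.ext_iff.1 this).1
  · intro u hu
    exact hu.2
  · intro u hu
    have := hr u hu.1
    rw [hee] at this
    exact (Prod.ext_iff.1 this).2
  · intro h hh
    have h0 : S.φ g h = 0 := S.φ_eq_zero hg hh.1 hh.2.2.2
    have h1 : e h = (0, π h) := by rw [hee, h0]
    have h2 : e.symm (0, π h) = h := by rw [← h1]; exact e.left_inv hh.2.1.1
    refine ⟨⟨?_, ?_⟩, h2⟩
    · change ((0 : ℝ), π h) ∈ e.target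
      rw [← h1]; exact e.map_source hh.2.1.1
    · change e.symm (0, π h) ∈ (e.source ∩ e ⁻¹' T') ∩ (V' ∩ S.dom g)
      rw [h2]; exact hh.2

/-- The surface need not be closed, but in each `dom g` it is the zero set of a continuous function.
Hence it is locally closed, the intersection of an open and a closed set. -/
lemma measurableSet_carrier : MeasurableSet S.carrier := by
  have h : IsLocallyClosed S.carrier := by
    refine ((isLocallyClosed_tfae S.carrier).out 0 3 rfl rfl).2 fun g hg =>
      ⟨S.dom g, S.mem_dom g hg, S.isOpen_dom g hg, ?_⟩
    rintro h ⟨hd, hc⟩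
    refine S.mem_carrier hg hd ?_
    have hcont : ContinuousAt (S.φ g) h := (S.differentiableAt hg hd).continuousAt
    have : (𝓝[S.carrier] h).NeBot := mem_closure_iff_nhdsWithin_neBot.1 hc
    refine tendsto_nhds_unique
      (hcont.tendsto.mono_left (nhdsWithin_le_nhds (s := S.carrier))) ?_
    refine tendsto_const_nhds.congr' ?_
    filter_upwards [self_mem_nhdsWithin,
      mem_nhdsWithin_of_mem_nhds ((S.isOpen_dom g hg).mem_nhds hd)] with w h1 h2
    exact (S.φ_eq_zero hg h1 h2).symm
  obtain ⟨A, B, hA, hB, h⟩ := h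
  rw [h]
  exact hA.measurableSet.inter hB.measurableSet

/-- Derivatives in tangential directions depend only on the values on the surface. -/
lemma fderiv_eq_of_eventuallyEq {g : Heis} (hg : g ∈ S.carrier) {f₁ f₂ : Heis → ℝ}
    (h₁ : DifferentiableAt ℝ f₁ g) (h₂ : DifferentiableAt ℝ f₂ g)
    (h : f₁ =ᶠ[𝓝[S.carrier] g] f₂) {v : Heis} (hv : fderiv ℝ (S.φ g) g v = 0) :
    fderiv ℝ f₁ g v = fderiv ℝ f₂ g v := by
  obtain ⟨O, U, θ, π, hc, hgO, hOd, -, hπ⟩ := S.exists_chart hg univ_mem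
  obtain ⟨hu, hθ⟩ := hc.inv g ⟨hg, hgO⟩
  have hd := hc.differentiableAt hu
  have hcomp : ∀ f : Heis → ℝ, DifferentiableAt ℝ f g → ∀ w,
      fderiv ℝ (f ∘ θ) (π g) w = fderiv ℝ f g (fderiv ℝ θ (π g) w) := fun f hf w => by
    rw [fderiv_comp (π g) (by rwa [hθ]) hd, hθ]; rfl
  have hev : ∀ f f' : Heis → ℝ, f =ᶠ[𝓝[S.carrier] g] f' →
      fderiv ℝ (f ∘ θ) (π g) = fderiv ℝ (f' ∘ θ) (π g) := fun f f' hff => by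
    have ht : Tendsto θ (𝓝 (π g)) (𝓝[S.carrier] g) := by
      refine tendsto_nhdsWithin_iff.2 ⟨?_, ?_⟩
      · have := hd.continuousAt.tendsto
        rwa [hθ] at this
      · filter_upwards [hc.isOpen.mem_nhds hu] with w hw using hc.mapsTo hw
    exact EventuallyEq.fderiv_eq (ht.eventually hff)
  -- Tangent vectors are velocities of the chart. The two sides have the same image under `π`, and
  -- both are killed by the differential of the defining function, so they agree by the choice of
  -- `π`.
  have htan : fderiv ℝ θ (π g) (π v) = v := by
    rw [← sub_eq_zero]
    apply hπ
    · rw [map_sub, hv, sub_zero,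
        ← hcomp _ (S.differentiableAt hg (S.mem_dom g hg)), hev (S.φ g) (fun _ => 0) ?_]
      · have : (fun _ => (0 : ℝ)) ∘ θ = fun _ => 0 := rfl
        rw [this]
        simp
      · filter_upwards [self_mem_nhdsWithin,
          mem_nhdsWithin_of_mem_nhds ((S.isOpen_dom g hg).mem_nhds (S.mem_dom g hg))] with w h1 h2
        exact S.φ_eq_zero hg h1 h2
    · rw [map_sub, hc.proj_fderiv hu, sub_self]
  rw [← htan, ← hcomp f₁ h₁, ← hcomp f₂ h₂, hev f₁ f₂ h]

end OrientedC2Surface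

/-! ### Regularity of the geometric quantities -/

lemma contDiff_X1 {n : WithTop ℕ∞} : ContDiff ℝ n X1 := by
  unfold X1; fun_prop

lemma contDiff_X2 {n : WithTop ℕ∞} : ContDiff ℝ n X2 := by
  unfold X2; fun_prop

lemma contDiff_T {n : WithTop ℕ∞} : ContDiff ℝ n T := by
  unfold T; fun_prop

lemma contDiffAt_along {V : Heis → Heis} {f : Heis → ℝ} {g : Heis} (hV : ContDiffAt ℝ 1 V g)
    (hf : ContDiffAt ℝ 2 f g) : ContDiffAt ℝ 1 (along V f) g :=
  (hf.fderiv_right (m := 1) (by norm_num)).clm_apply hV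

lemma continuousAt_along {V : Heis → Heis} {f : Heis → ℝ} {g : Heis} (hV : ContinuousAt V g)
    (hf : ContDiffAt ℝ 1 f g) : ContinuousAt (along V f) g :=
  (hf.fderiv_right (m := 0) (by norm_num)).continuousAt.clm_apply hV

section Regularity

variable {φ : Heis → ℝ} {g : Heis}

lemma sq_add_sq_ne_zero_of_W (hW : W φ g ≠ 0) :
    along X1 φ g ^ 2 + along X2 φ g ^ 2 ≠ 0 := fun h => hW (by rw [W, h, Real.sqrt_zero])

lemma contDiffAt_W (hφ : ContDiffAt ℝ 2 φ g) (hW : W φ g ≠ 0) : ContDiffAt ℝ 1 (W φ) g :=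
  (((contDiffAt_along contDiff_X1.contDiffAt hφ).pow 2).add
    ((contDiffAt_along contDiff_X2.contDiffAt hφ).pow 2)).sqrt (sq_add_sq_ne_zero_of_W hW)

lemma contDiffAt_pbar (hφ : ContDiffAt ℝ 2 φ g) (hW : W φ g ≠ 0) : ContDiffAt ℝ 1 (pbar φ) g :=
  (contDiffAt_along contDiff_X1.contDiffAt hφ).div (contDiffAt_W hφ hW) hW

lemma contDiffAt_qbar (hφ : ContDiffAt ℝ 2 φ g) (hW : W φ g ≠ 0) : ContDiffAt ℝ 1 (qbar φ) g :=
  (contDiffAt_along contDiff_X2.contDiffAt hφ).div (contDiffAt_W hφ hW) hW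

lemma contDiffAt_omegabar (hφ : ContDiffAt ℝ 2 φ g) (hW : W φ g ≠ 0) :
    ContDiffAt ℝ 1 (omegabar φ) g :=
  (contDiffAt_along contDiff_T.contDiffAt hφ).div (contDiffAt_W hφ hW) hW

lemma contDiffAt_Y (hφ : ContDiffAt ℝ 2 φ g) (hW : W φ g ≠ 0) : ContDiffAt ℝ 1 (Y φ) g :=
  ((contDiffAt_pbar hφ hW).smul contDiff_X1.contDiffAt).add
    ((contDiffAt_qbar hφ hW).smul contDiff_X2.contDiffAt)

lemma contDiffAt_Z (hφ : ContDiffAt ℝ 2 φ g) (hW : W φ g ≠ 0) : ContDiffAt ℝ 1 (Z φ) g :=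
  ((contDiffAt_qbar hφ hW).smul contDiff_X1.contDiffAt).sub
    ((contDiffAt_pbar hφ hW).smul contDiff_X2.contDiffAt)

lemma continuousAt_potential (hφ : ContDiffAt ℝ 2 φ g) (hW : W φ g ≠ 0) :
    ContinuousAt (potential φ) g := by
  have hp := contDiffAt_pbar hφ hW
  have hq := contDiffAt_qbar hφ hW
  have hω := contDiffAt_omegabar hφ hW
  have hY := (contDiffAt_Y hφ hW).continuousAt
  have hZ := (contDiffAt_Z hφ hW).continuousAt
  have hT : ContinuousAt T g := (contDiff_T (n := 1)).continuous.continuousAt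
  have h1 : ContinuousAt X1 g := (contDiff_X1 (n := 1)).continuous.continuousAt
  have h2 : ContinuousAt X2 g := (contDiff_X2 (n := 1)).continuous.continuousAt
  have hp' := hp.continuousAt
  have hq' := hq.continuousAt
  have hω' := hω.continuousAt
  exact ((((((hp'.mul (continuousAt_along hT hq)).add (hq'.mul (continuousAt_along hT hp))).sub
    (hω'.mul ((hp'.mul (continuousAt_along hY hq)).add
      (hq'.mul (continuousAt_along hY hp))))).sub ((hq'.pow 2).mul (hω'.pow 2))).sub
    (continuousAt_along hZ hω)).sub (((hp'.mul hq').mul hω').mul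
      ((continuousAt_along h1 hp).add (continuousAt_along h2 hq))))

lemma pbar_sq_add_qbar_sq (hW : W φ g ≠ 0) : pbar φ g ^ 2 + qbar φ g ^ 2 = 1 := by
  have h : W φ g ^ 2 = along X1 φ g ^ 2 + along X2 φ g ^ 2 := Real.sq_sqrt (by positivity)
  rw [pbar, qbar, div_pow, div_pow, ← add_div, ← h, div_self (pow_ne_zero 2 hW)]

/-- Half the derivative of `p̄² + q̄² = 1`, which holds on a full neighbourhood, so the direction is
unrestricted. -/
lemma pbar_mul_fderiv_add (hφ : ContDiffAt ℝ 2 φ g) (hW : W φ g ≠ 0) (v : Heis) :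
    pbar φ g * fderiv ℝ (pbar φ) g v + qbar φ g * fderiv ℝ (qbar φ) g v = 0 := by
  have hp := (contDiffAt_pbar hφ hW).differentiableAt one_ne_zero
  have hq := (contDiffAt_qbar hφ hW).differentiableAt one_ne_zero
  have h1 : (fun h => pbar φ h ^ 2 + qbar φ h ^ 2) =ᶠ[𝓝 g] fun _ => 1 := by
    filter_upwards [(contDiffAt_W hφ hW).continuousAt.eventually_ne hW] with h hh
      using pbar_sq_add_qbar_sq hh
  have h2 := ((hp.hasFDerivAt.pow 2).add (hq.hasFDerivAt.pow 2)).congr_of_eventuallyEq h1.symm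
  have h3 := h2.unique (hasFDerivAt_const (1 : ℝ) g)
  have h4 := congrArg (fun A => A v) h3
  simp at h4
  linarith

lemma fderiv_apply_Y (f : Heis → ℝ) :
    fderiv ℝ f g (Y φ g) = pbar φ g * along X1 f g + qbar φ g * along X2 f g := by
  simp [Y, along]

lemma fderiv_apply_Z (f : Heis → ℝ) :
    fderiv ℝ f g (Z φ g) = qbar φ g * along X1 f g - pbar φ g * along X2 f g := by
  simp [Z, along]

/-! ### Tangential fields, the potential and the Stokes integrand -/

/-- The tangential field `T - ω̄ Y`. -/
def tangentT (φ : Heis → ℝ) (g : Heis) : Heis := T g - omegabar φ g • Y φ g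

lemma fderiv_apply_tangentT (f : Heis → ℝ) :
    fderiv ℝ f g (tangentT φ g) = along T f g -
      omegabar φ g * (pbar φ g * along X1 f g + qbar φ g * along X2 f g) := by
  rw [← fderiv_apply_Y]
  simp [tangentT, along]

lemma fderiv_Z_eq_zero : fderiv ℝ φ g (Z φ g) = 0 := by
  rw [fderiv_apply_Z, pbar, qbar]
  ring

/-- Here `Yφ = W` and `Tφ = ω̄W`, so subtracting `ω̄Y` removes the part of `T` transversal to the
level set. -/
lemma fderiv_tangentT_eq_zero (hW : W φ g ≠ 0) : fderiv ℝ φ g (tangentT φ g) = 0 := by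
  have h1 : along X1 φ g = pbar φ g * W φ g := by rw [pbar, div_mul_cancel₀ _ hW]
  have h2 : along X2 φ g = qbar φ g * W φ g := by rw [qbar, div_mul_cancel₀ _ hW]
  have h3 : along T φ g = omegabar φ g * W φ g := by rw [omegabar, div_mul_cancel₀ _ hW]
  rw [fderiv_apply_tangentT, h1, h2, h3]
  linear_combination (-(omegabar φ g * W φ g)) * pbar_sq_add_qbar_sq hW

/-- The potential in terms of tangential derivatives. -/
lemma potential_eq (hφ : ContDiffAt ℝ 2 φ g) (hW : W φ g ≠ 0) :
    potential φ g = pbar φ g * fderiv ℝ (qbar φ) g (tangentT φ g) +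
      qbar φ g * fderiv ℝ (pbar φ) g (tangentT φ g) - qbar φ g ^ 2 * omegabar φ g ^ 2 -
      fderiv ℝ (omegabar φ) g (Z φ g) - pbar φ g * qbar φ g * omegabar φ g *
        (qbar φ g * fderiv ℝ (pbar φ) g (Z φ g) - pbar φ g * fderiv ℝ (qbar φ) g (Z φ g)) := by
  have h0 := pbar_sq_add_qbar_sq hW
  have h1 := pbar_mul_fderiv_add hφ hW (X1 g)
  have h2 := pbar_mul_fderiv_add hφ hW (X2 g)
  have e1 : along (Z φ) (omegabar φ) g = fderiv ℝ (omegabar φ) g (Z φ g) := rfl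
  have e2 : along (Y φ) (pbar φ) g = fderiv ℝ (pbar φ) g (Y φ g) := rfl
  have e3 : along (Y φ) (qbar φ) g = fderiv ℝ (qbar φ) g (Y φ g) := rfl
  rw [potential, meanCurvature, e1, e2, e3]
  simp only [fderiv_apply_Y, fderiv_apply_Z, fderiv_apply_tangentT]
  simp only [along] at h1 h2 ⊢
  generalize fderiv ℝ (pbar φ) g (X1 g) = p1 at *
  generalize fderiv ℝ (pbar φ) g (X2 g) = p2 at *
  generalize fderiv ℝ (qbar φ) g (X1 g) = q1 at *
  generalize fderiv ℝ (qbar φ) g (X2 g) = q2 at *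
  generalize pbar φ g = p at *
  generalize qbar φ g = q at *
  -- Only the curvature term needs work: differentiating `p̄² + q̄² = 1` along `X₁` and `X₂` gives
  -- `X₁p̄ + X₂q̄ = q̄ Zp̄ - p̄ Zq̄`. The other terms already group into `T - ω̄Y`.
  linear_combination (p * q * omegabar φ g) * (p1 + q2) * h0 -
    (p * q * omegabar φ g) * (p * h1 + q * h2)

/-- The integrand of Stokes' formula on the surface, for the one-form with components
`f · (-p̄ q̄², p̄² q̄, -ω̄)` in the frame. -/
def stokesDensity (φ f : Heis → ℝ) (g : Heis) : ℝ :=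
  omegabar φ g * fderiv ℝ f g (Z φ g) - pbar φ g * qbar φ g * fderiv ℝ f g (tangentT φ g) +
    f g * (pbar φ g ^ 2 * omegabar φ g ^ 2 - potential φ g)

/-- The left side is the exterior derivative of the form contracted with the normal `(p̄, q̄, ω̄)`;
the isolated `E 2` is due to `[X₁, X₂] = T`. Derivatives of `f` yield the first-order part of
`stokesDensity`, and derivatives of the coefficients yield the potential, after reduction by `p̄² +
q̄² = 1` and its `T`-derivative. -/
lemma stokesDensity_eq_curl {f : Heis → ℝ} (hφ : ContDiffAt ℝ 2 φ g) (hW : W φ g ≠ 0)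
    (hf : DifferentiableAt ℝ f g) {E : Fin 3 → Heis → ℝ}
    (hE : E = ![fun h => f h * (-(pbar φ h * qbar φ h ^ 2)),
      fun h => f h * (pbar φ h ^ 2 * qbar φ h), fun h => f h * (-omegabar φ h)]) :
    pbar φ g * (along X2 (E 2) g - along T (E 1) g) +
      qbar φ g * (along T (E 0) g - along X1 (E 2) g) +
      omegabar φ g * (along X1 (E 1) g - along X2 (E 0) g - E 2 g) = stokesDensity φ f g := by
  have hp := ((contDiffAt_pbar hφ hW).differentiableAt one_ne_zero).hasFDerivAt
  have hq := ((contDiffAt_qbar hφ hW).differentiableAt one_ne_zero).hasFDerivAt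
  have hω := ((contDiffAt_omegabar hφ hW).differentiableAt one_ne_zero).hasFDerivAt
  have d0 := (hf.hasFDerivAt.mul (hp.mul (hq.pow 2)).neg).fderiv
  have d1 := (hf.hasFDerivAt.mul ((hp.pow 2).mul hq)).fderiv
  have d2 := (hf.hasFDerivAt.mul hω.neg).fderiv
  have h0 := pbar_sq_add_qbar_sq hW
  have h3 := pbar_mul_fderiv_add hφ hW (T g)
  have E0 : ∀ v, fderiv ℝ (E 0) g v = fderiv ℝ f g v * (-(pbar φ g * qbar φ g ^ 2)) -
      f g * (fderiv ℝ (pbar φ) g v * qbar φ g ^ 2 +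
        pbar φ g * (2 * qbar φ g * fderiv ℝ (qbar φ) g v)) := fun v => by
    have := congrArg (fun A => A v) d0
    rw [hE]
    refine Eq.trans this ?_
    simp
    ring
  have E1 : ∀ v, fderiv ℝ (E 1) g v = fderiv ℝ f g v * (pbar φ g ^ 2 * qbar φ g) +
      f g * (2 * pbar φ g * fderiv ℝ (pbar φ) g v * qbar φ g +
        pbar φ g ^ 2 * fderiv ℝ (qbar φ) g v) := fun v => by
    have := congrArg (fun A => A v) d1
    rw [hE]
    refine Eq.trans this ?_
    simp
    ring
  have E2 : ∀ v, fderiv ℝ (E 2) g v = fderiv ℝ f g v * (-omegabar φ g) -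
      f g * fderiv ℝ (omegabar φ) g v := fun v => by
    have := congrArg (fun A => A v) d2
    rw [hE]
    refine Eq.trans this ?_
    simp
    ring
  have E2' : E 2 g = f g * (-omegabar φ g) := by rw [hE]; rfl
  rw [stokesDensity, potential, meanCurvature, E2', fderiv_apply_Z, fderiv_apply_tangentT]
  simp only [along, E0, E1, E2]
  rw [fderiv_apply_Y, fderiv_apply_Y, fderiv_apply_Z]
  simp only [along] at h3 ⊢
  generalize fderiv ℝ (pbar φ) g (X1 g) = p1 at *
  generalize fderiv ℝ (pbar φ) g (X2 g) = p2 at *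
  generalize fderiv ℝ (pbar φ) g (T g) = p3 at *
  generalize fderiv ℝ (qbar φ) g (X1 g) = q1 at *
  generalize fderiv ℝ (qbar φ) g (X2 g) = q2 at *
  generalize fderiv ℝ (qbar φ) g (T g) = q3 at *
  generalize fderiv ℝ (omegabar φ) g (X1 g) = w1 at *
  generalize fderiv ℝ (omegabar φ) g (X2 g) = w2 at *
  generalize fderiv ℝ f g (X1 g) = f1 at *
  generalize fderiv ℝ f g (X2 g) = f2 at *
  generalize fderiv ℝ f g (T g) = f3 at *
  generalize pbar φ g = p at *
  generalize qbar φ g = q at *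
  generalize omegabar φ g = w at *
  generalize f g = F at *
  linear_combination (-(f3 * p * q) - F * (p * q3 + q * p3) - F * w ^ 2) * h0 - F * p * q * h3

/-- The second variation density, up to an integrand of Stokes' formula. -/
lemma second_variation_density {a : Heis → ℝ} (hW : W φ g ≠ 0) (ha : DifferentiableAt ℝ a g) :
    pbar φ g ^ 2 * (fderiv ℝ a g (Z φ g) + a g * omegabar φ g) ^ 2 +
      2 * qbar φ g * (a g * (omegabar φ g * along X1 a g - pbar φ g * along T a g)) =
    pbar φ g ^ 2 * tangentialGradSq φ a g + a g ^ 2 * potential φ g +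
      stokesDensity φ (fun h => a h ^ 2) g := by
  have h0 := pbar_sq_add_qbar_sq hW
  have d : ∀ v, fderiv ℝ (fun h => a h ^ 2) g v = 2 * a g * fderiv ℝ a g v := fun v => by
    have := congrArg (fun A => A v) (ha.hasFDerivAt.pow 2).fderiv
    refine Eq.trans this ?_
    simp
  rw [stokesDensity, tangentialGradSq, d, d, fderiv_apply_Z, fderiv_apply_tangentT]
  generalize along X1 a g = a1
  generalize along X2 a g = a2
  generalize along T a g = a3
  generalize a g = A
  generalize omegabar φ g = w
  generalize potential φ g = V
  generalize pbar φ g = p at *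
  generalize qbar φ g = q at *
  linear_combination
    (p ^ 2 * (a1 ^ 2 + a2 ^ 2 - (a1 * p + a2 * q) ^ 2) - 2 * A * w * a2 * p) * h0

end Regularity

namespace OrientedC2Surface

variable (S : OrientedC2Surface)

/-! ### Independence of the defining function -/

/-- Quotients by `W` are homogeneous of degree zero. Positivity of `c` matters: a negative factor
would flip all three signs, so this is where the orientation enters. -/
lemma W_eq_mul {φ ψ : Heis → ℝ} {g : Heis} {c : ℝ} (hc : 0 < c) (h : rgrad φ g = c • rgrad ψ g) :
    W φ g = c * W ψ g ∧ pbar φ g = pbar ψ g ∧ qbar φ g = qbar ψ g ∧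
      omegabar φ g = omegabar ψ g := by
  have h0 : along X1 φ g = c * along X1 ψ g := congrFun h 0
  have h1 : along X2 φ g = c * along X2 ψ g := congrFun h 1
  have h2 : along T φ g = c * along T ψ g := congrFun h 2
  have hW : W φ g = c * W ψ g := by
    rw [W, h0, h1, W, show (c * along X1 ψ g) ^ 2 + (c * along X2 ψ g) ^ 2 =
      c ^ 2 * (along X1 ψ g ^ 2 + along X2 ψ g ^ 2) by ring, Real.sqrt_mul (sq_nonneg c),
      Real.sqrt_sq hc.le]
  refine ⟨hW, ?_, ?_, ?_⟩
  · rw [pbar, pbar, hW, h0, mul_div_mul_left _ _ hc.ne']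
  · rw [qbar, qbar, hW, h1, mul_div_mul_left _ _ hc.ne']
  · rw [omegabar, omegabar, hW, h2, mul_div_mul_left _ _ hc.ne']

/-- If `W` vanished, the gradient would be a nonzero multiple of `T` and the tangent plane would be
the horizontal one. -/
lemma W_self_ne_zero (hS : S.charLocus = ∅) {g : Heis} (hg : g ∈ S.carrier) :
    W (S.φ g) g ≠ 0 := by
  intro h0
  have h1 : along X1 (S.φ g) g ^ 2 + along X2 (S.φ g) g ^ 2 = 0 :=
    (Real.sqrt_eq_zero (by positivity)).1 h0
  have hX1 : along X1 (S.φ g) g = 0 := by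
    nlinarith [sq_nonneg (along X1 (S.φ g) g), sq_nonneg (along X2 (S.φ g) g)]
  have hX2 : along X2 (S.φ g) g = 0 := by
    nlinarith [sq_nonneg (along X1 (S.φ g) g), sq_nonneg (along X2 (S.φ g) g)]
  have hT : along T (S.φ g) g ≠ 0 := by
    intro hT
    apply S.rgrad_ne_zero g hg g (S.mem_dom g hg)
    ext i
    fin_cases i <;> simp [rgrad, hX1, hX2, hT]
  have : g ∈ S.charLocus := by
    refine ⟨hg, le_antisymm ?_ ?_⟩
    · intro v hv
      have hv' : fderiv ℝ (S.φ g) g v = 0 := hv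
      rw [fderiv_apply_eq_frame, hX1, hX2] at hv'
      have h2 : frameCoord g v 2 = 0 := by simpa [hT] using hv'
      rw [← frameCoord_spec g v, h2, zero_smul, add_zero]
      exact Submodule.add_mem _
        (Submodule.smul_mem _ _ (Submodule.subset_span (Set.mem_insert _ _)))
        (Submodule.smul_mem _ _ (Submodule.subset_span (Set.mem_insert_of_mem _ rfl)))
    · refine Submodule.span_le.2 ?_
      rintro v (rfl | rfl)
      · exact hX1
      · exact hX2
  rw [hS] at this
  exact this

lemma W_ne_zero (hS : S.charLocus = ∅) {g h : Heis} (hg : g ∈ S.carrier) (hh : h ∈ S.carrier)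
    (hd : h ∈ S.dom g) : W (S.φ g) h ≠ 0 := by
  obtain ⟨c, hc, hr⟩ := S.oriented g hg h hh h ⟨⟨hh, hd⟩, S.mem_dom h hh⟩
  rw [(W_eq_mul hc hr).1]
  exact mul_ne_zero hc.ne' (S.W_self_ne_zero hS hh)

lemma bar_eq {g g' h : Heis} (hg : g ∈ S.carrier) (hg' : g' ∈ S.carrier) (hh : h ∈ S.carrier)
    (hd : h ∈ S.dom g) (hd' : h ∈ S.dom g') :
    pbar (S.φ g) h = pbar (S.φ g') h ∧ qbar (S.φ g) h = qbar (S.φ g') h ∧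
      omegabar (S.φ g) h = omegabar (S.φ g') h := by
  obtain ⟨c, hc, hr⟩ := S.oriented g hg g' hg' h ⟨⟨hh, hd⟩, hd'⟩
  exact (W_eq_mul hc hr).2

lemma eventually_bar_eq {g g' h : Heis} (hg : g ∈ S.carrier) (hg' : g' ∈ S.carrier)
    (hd : h ∈ S.dom g) (hd' : h ∈ S.dom g') :
    ∀ᶠ w in 𝓝[S.carrier] h, pbar (S.φ g) w = pbar (S.φ g') w ∧
      qbar (S.φ g) w = qbar (S.φ g') w ∧ omegabar (S.φ g) w = omegabar (S.φ g') w := by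
  filter_upwards [self_mem_nhdsWithin,
    mem_nhdsWithin_of_mem_nhds ((S.isOpen_dom g hg).mem_nhds hd),
    mem_nhdsWithin_of_mem_nhds ((S.isOpen_dom g' hg').mem_nhds hd')] with w h1 h2 h3
  exact S.bar_eq hg hg' h1 h2 h3

lemma Z_eq {g h : Heis} (hg : g ∈ S.carrier) (hh : h ∈ S.carrier) (hd : h ∈ S.dom g) :
    Z (S.φ g) h = Z (S.φ h) h ∧ tangentT (S.φ g) h = tangentT (S.φ h) h := by
  obtain ⟨h1, h2, h3⟩ := S.bar_eq hg hh hh hd (S.mem_dom h hh)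
  rw [Z, Z, tangentT, tangentT, Y, Y, h1, h2, h3]
  exact ⟨rfl, rfl⟩

/-- As written, the potential contains derivatives transversal to the surface, where two defining
functions may differ. By `potential_eq` these recombine into derivatives of `p̄`, `q̄`, `ω̄` along
`Z` and `T - ω̄Y`, which are determined by the values on the surface. -/
lemma potential_eq_self (hS : S.charLocus = ∅) {g h : Heis} (hg : g ∈ S.carrier)
    (hh : h ∈ S.carrier) (hd : h ∈ S.dom g) : potential (S.φ g) h = potential (S.φ h) h := by
  have hd' := S.mem_dom h hh
  have hW := S.W_ne_zero hS hg hh hd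
  have hW' := S.W_ne_zero hS hh hh hd'
  have c := S.contDiffAt hg hd
  have c' := S.contDiffAt hh hd'
  obtain ⟨h1, h2, h3⟩ := S.bar_eq hg hh hh hd hd'
  obtain ⟨e1, e2⟩ := S.Z_eq hg hh hd
  have ev := S.eventually_bar_eq hg hh hd hd'
  have hp : ∀ v, fderiv ℝ (S.φ h) h v = 0 →
      fderiv ℝ (pbar (S.φ g)) h v = fderiv ℝ (pbar (S.φ h)) h v := fun v hv =>
    S.fderiv_eq_of_eventuallyEq hh ((contDiffAt_pbar c hW).differentiableAt one_ne_zero)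
      ((contDiffAt_pbar c' hW').differentiableAt one_ne_zero) (ev.mono fun w h => h.1) hv
  have hq : ∀ v, fderiv ℝ (S.φ h) h v = 0 →
      fderiv ℝ (qbar (S.φ g)) h v = fderiv ℝ (qbar (S.φ h)) h v := fun v hv =>
    S.fderiv_eq_of_eventuallyEq hh ((contDiffAt_qbar c hW).differentiableAt one_ne_zero)
      ((contDiffAt_qbar c' hW').differentiableAt one_ne_zero) (ev.mono fun w h => h.2.1) hv
  have hω : ∀ v, fderiv ℝ (S.φ h) h v = 0 →
      fderiv ℝ (omegabar (S.φ g)) h v = fderiv ℝ (omegabar (S.φ h)) h v := fun v hv =>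
    S.fderiv_eq_of_eventuallyEq hh ((contDiffAt_omegabar c hW).differentiableAt one_ne_zero)
      ((contDiffAt_omegabar c' hW').differentiableAt one_ne_zero) (ev.mono fun w h => h.2.2) hv
  have t1 : fderiv ℝ (S.φ h) h (Z (S.φ h) h) = 0 := fderiv_Z_eq_zero
  have t2 := fderiv_tangentT_eq_zero hW'
  rw [potential_eq c hW, potential_eq c' hW', e1, e2, h1, h2, h3, hp _ t1, hp _ t2, hq _ t1,
    hq _ t2, hω _ t1]

lemma stokesDensity_eq_self (hS : S.charLocus = ∅) (f : Heis → ℝ) {g h : Heis}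
    (hg : g ∈ S.carrier) (hh : h ∈ S.carrier) (hd : h ∈ S.dom g) :
    stokesDensity (S.φ g) f h = stokesDensity (S.φ h) f h := by
  obtain ⟨h1, h2, h3⟩ := S.bar_eq hg hh hh hd (S.mem_dom h hh)
  obtain ⟨e1, e2⟩ := S.Z_eq hg hh hd
  rw [stokesDensity, stokesDensity, h1, h2, h3, e1, e2, S.potential_eq_self hS hg hh hd]

/-- The integrand of Stokes' formula depends only on the values of the function on the surface. -/
lemma stokesDensity_congr (hS : S.charLocus = ∅) {f f' : Heis → ℝ} {g : Heis}
    (hg : g ∈ S.carrier) (hf : DifferentiableAt ℝ f g) (hf' : DifferentiableAt ℝ f' g)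
    (h : f =ᶠ[𝓝[S.carrier] g] f') :
    stokesDensity (S.φ g) f g = stokesDensity (S.φ g) f' g := by
  have t2 := fderiv_tangentT_eq_zero (S.W_self_ne_zero hS hg)
  rw [stokesDensity, stokesDensity, S.fderiv_eq_of_eventuallyEq hg hf hf' h fderiv_Z_eq_zero,
    S.fderiv_eq_of_eventuallyEq hg hf hf' h t2, h.self_of_nhdsWithin hg]

/-- The family `g ↦ φ g` carries no regularity in `g`. Continuity is read off from one fixed
defining function, which near a point computes the same values on the surface. -/
lemma continuousOn_of_local {F : (Heis → ℝ) → Heis → ℝ}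
    (hF : ∀ g ∈ S.carrier, ∀ h ∈ S.carrier, h ∈ S.dom g → F (S.φ g) h = F (S.φ h) h)
    (hc : ∀ g ∈ S.carrier, ContinuousAt (F (S.φ g)) g) :
    ContinuousOn (fun g => F (S.φ g) g) S.carrier := by
  intro g hg
  refine (hc g hg).continuousWithinAt.congr_of_eventuallyEq ?_ rfl
  filter_upwards [self_mem_nhdsWithin,
    mem_nhdsWithin_of_mem_nhds ((S.isOpen_dom g hg).mem_nhds (S.mem_dom g hg))] with h h1 h2
  exact (hF g hg h h1 h2).symm

lemma contDiffAt_self {g : Heis} (hg : g ∈ S.carrier) : ContDiffAt ℝ 2 (S.φ g) g :=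
  S.contDiffAt hg (S.mem_dom g hg)

lemma continuousOn_pbar (hS : S.charLocus = ∅) :
    ContinuousOn (fun g => pbar (S.φ g) g) S.carrier :=
  S.continuousOn_of_local (F := pbar)
    (fun _ hg h hh hd => (S.bar_eq hg hh hh hd (S.mem_dom h hh)).1)
    fun _ hg => (contDiffAt_pbar (S.contDiffAt_self hg) (S.W_self_ne_zero hS hg)).continuousAt

lemma continuousOn_qbar (hS : S.charLocus = ∅) :
    ContinuousOn (fun g => qbar (S.φ g) g) S.carrier :=
  S.continuousOn_of_local (F := qbar)
    (fun _ hg h hh hd => (S.bar_eq hg hh hh hd (S.mem_dom h hh)).2.1)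
    fun _ hg => (contDiffAt_qbar (S.contDiffAt_self hg) (S.W_self_ne_zero hS hg)).continuousAt

lemma continuousOn_omegabar (hS : S.charLocus = ∅) :
    ContinuousOn (fun g => omegabar (S.φ g) g) S.carrier :=
  S.continuousOn_of_local (F := omegabar)
    (fun _ hg h hh hd => (S.bar_eq hg hh hh hd (S.mem_dom h hh)).2.2)
    fun _ hg => (contDiffAt_omegabar (S.contDiffAt_self hg) (S.W_self_ne_zero hS hg)).continuousAt

lemma continuousOn_potential (hS : S.charLocus = ∅) :
    ContinuousOn (fun g => potential (S.φ g) g) S.carrier :=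
  S.continuousOn_of_local (F := potential)
    (fun _ hg _ hh hd => S.potential_eq_self hS hg hh hd)
    fun _ hg => continuousAt_potential (S.contDiffAt_self hg) (S.W_self_ne_zero hS hg)

lemma continuousOn_stokesDensity (hS : S.charLocus = ∅) {f : Heis → ℝ} (hf : ContDiff ℝ 1 f) :
    ContinuousOn (fun g => stokesDensity (S.φ g) f g) S.carrier := by
  have hd : Continuous fun g => fderiv ℝ f g := hf.continuous_fderiv one_ne_zero
  have h1 := S.continuousOn_pbar hS
  have h2 := S.continuousOn_qbar hS
  have h3 := S.continuousOn_omegabar hS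
  have h4 := S.continuousOn_potential hS
  have a1 : ContinuousOn (along X1 f) S.carrier :=
    (hd.clm_apply (contDiff_X1 (n := 1)).continuous).continuousOn
  have a2 : ContinuousOn (along X2 f) S.carrier :=
    (hd.clm_apply (contDiff_X2 (n := 1)).continuous).continuousOn
  have a3 : ContinuousOn (along T f) S.carrier :=
    (hd.clm_apply (contDiff_T (n := 1)).continuous).continuousOn
  simp only [stokesDensity, fderiv_apply_Z, fderiv_apply_tangentT]
  exact ((h3.mul ((h2.mul a1).sub (h1.mul a2))).sub ((h1.mul h2).mul
    (a3.sub (h3.mul ((h1.mul a1).add (h2.mul a2)))))).add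
    (hf.continuous.continuousOn.mul (((h1.pow 2).mul (h3.pow 2)).sub h4))

end OrientedC2Surface

/-! ### Stokes' formula on the surface -/

/-- The pull-back under `θ` of the one-form with components `E` in the frame, applied to `v`. -/
def pullback (θ : ℝ × ℝ → Heis) (E : Fin 3 → Heis → ℝ) (v u : ℝ × ℝ) : ℝ :=
  E 0 (θ u) * frameCoord (θ u) (fderiv ℝ θ u v) 0 +
    E 1 (θ u) * frameCoord (θ u) (fderiv ℝ θ u v) 1 +
    E 2 (θ u) * frameCoord (θ u) (fderiv ℝ θ u v) 2

/-- The product rule gives three kinds of terms: derivatives of the coefficients, the second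
derivative of `θ`, and a term from the dependence of the frame on the base point. After
antisymmetrization in `v, w` the second kind cancels and the third produces the structure term with
`E 2`. -/
lemma fderiv_pullback {θ : ℝ × ℝ → Heis} {E : Fin 3 → Heis → ℝ} {u : ℝ × ℝ}
    (hθ : ContDiffAt ℝ 2 θ u) (hE : ∀ i, DifferentiableAt ℝ (E i) (θ u)) (v w : ℝ × ℝ) :
    fderiv ℝ (pullback θ E v) u w =
      fderiv ℝ (E 0) (θ u) (fderiv ℝ θ u w) * frameCoord (θ u) (fderiv ℝ θ u v) 0 +
      fderiv ℝ (E 1) (θ u) (fderiv ℝ θ u w) * frameCoord (θ u) (fderiv ℝ θ u v) 1 +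
      fderiv ℝ (E 2) (θ u) (fderiv ℝ θ u w) * frameCoord (θ u) (fderiv ℝ θ u v) 2 +
      (E 0 (θ u) * frameCoord (θ u) (fderiv ℝ (fderiv ℝ θ) u w v) 0 +
        E 1 (θ u) * frameCoord (θ u) (fderiv ℝ (fderiv ℝ θ) u w v) 1 +
        E 2 (θ u) * frameCoord (θ u) (fderiv ℝ (fderiv ℝ θ) u w v) 2) +
      E 2 (θ u) * ((fderiv ℝ θ u w).2.1 / 2 * (fderiv ℝ θ u v).1 -
        (fderiv ℝ θ u w).1 / 2 * (fderiv ℝ θ u v).2.1) := by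
  have d0 := (hθ.differentiableAt two_ne_zero).hasFDerivAt
  have d1 : HasFDerivAt (fun u => fderiv ℝ θ u v)
      ((ContinuousLinearMap.apply ℝ Heis v).comp (fderiv ℝ (fderiv ℝ θ) u)) u := by
    have h1 : DifferentiableAt ℝ (fderiv ℝ θ) u :=
      (hθ.fderiv_right (m := 1) (by norm_num)).differentiableAt one_ne_zero
    exact (ContinuousLinearMap.apply ℝ Heis v).hasFDerivAt.comp u h1.hasFDerivAt
  have e : ∀ i, HasFDerivAt (fun u => E i (θ u))
      ((fderiv ℝ (E i) (θ u)).comp (fderiv ℝ θ u)) u := fun i =>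
    (hE i).hasFDerivAt.comp u d0
  have k := (((e 0).mul d1.fst).add ((e 1).mul d1.snd.fst)).add ((e 2).mul
    ((d1.snd.snd.add ((d0.snd.fst.mul_const (1 / 2)).mul d1.fst)).sub
      ((d0.fst.mul_const (1 / 2)).mul d1.snd.fst)))
  have k' : HasFDerivAt (pullback θ E v) _ u := k.congr_of_eventuallyEq
    (Eventually.of_forall fun u => by
      simp only [pullback, frameCoord, Matrix.cons_val_zero, Matrix.cons_val_one, Matrix.cons_val,
        Pi.add_apply, Pi.mul_apply, Pi.sub_apply]
      ring)
  rw [k'.fderiv]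
  simp [frameCoord]
  ring

/-- The exterior derivative of a one-form on a parametrized surface. -/
lemma fderiv_pullback_sub {θ : ℝ × ℝ → Heis} {E : Fin 3 → Heis → ℝ} {u : ℝ × ℝ}
    (hθ : ContDiffAt ℝ 2 θ u) (hE : ∀ i, DifferentiableAt ℝ (E i) (θ u)) :
    fderiv ℝ (pullback θ E (0, 1)) u (1, 0) - fderiv ℝ (pullback θ E (1, 0)) u (0, 1) =
      patchNormal θ u 0 * (along X2 (E 2) (θ u) - along T (E 1) (θ u)) +
      patchNormal θ u 1 * (along T (E 0) (θ u) - along X1 (E 2) (θ u)) +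
      patchNormal θ u 2 * (along X1 (E 1) (θ u) - along X2 (E 0) (θ u) - E 2 (θ u)) := by
  -- Symmetry of second derivatives; this is where `θ` has to be `C²`.
  have hsym : fderiv ℝ (fderiv ℝ θ) u (1, 0) (0, 1) = fderiv ℝ (fderiv ℝ θ) u (0, 1) (1, 0) :=
    (hθ.isSymmSndFDerivAt (by simp)).eq _ _
  rw [fderiv_pullback hθ hE, fderiv_pullback hθ hE, hsym, patchNormal_zero, patchNormal_one,
    patchNormal_two]
  simp only [fderiv_apply_eq_frame (E _)]
  simp only [frameCoord, Matrix.cons_val_zero, Matrix.cons_val_one, Matrix.cons_val]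
  ring

lemma IsChart.restrict {M O : Set Heis} {U U' : Set (ℝ × ℝ)} {θ : ℝ × ℝ → Heis}
    {π : Heis →L[ℝ] ℝ × ℝ} (h : IsChart M O U θ π) (hU' : IsOpen U') (hsub : U' ⊆ U) :
    IsChart M (O ∩ π ⁻¹' U') U' θ π where
  isOpen_nhd := h.isOpen_nhd.inter (hU'.preimage π.continuous)
  isOpen := hU'
  contDiffOn := h.contDiffOn.mono hsub
  mapsTo := h.mapsTo.mono_left hsub
  mapsTo_nhd u hu := ⟨h.mapsTo_nhd (hsub hu), by
    rw [Set.mem_preimage, h.proj_apply u (hsub hu)]; exact hu⟩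
  proj_apply u hu := h.proj_apply u (hsub hu)
  inv g hg := ⟨hg.2.2, (h.inv g ⟨hg.1, hg.2.1⟩).2⟩

namespace OrientedC2Surface

variable (S : OrientedC2Surface)

lemma patchNormal_eq_smul {g : Heis} (hg : g ∈ S.carrier) {U : Set (ℝ × ℝ)} {θ : ℝ × ℝ → Heis}
    (hθ : IsPatch S.carrier U θ) {u : ℝ × ℝ} (hu : u ∈ U) (hd : θ u ∈ S.dom g) :
    ∃ c : ℝ, c ≠ 0 ∧ patchNormal θ u = c • rgrad (S.φ g) (θ u) := by
  refine patchNormal_eq_smul_rgrad (hθ.differentiableAt hu) (hθ.immersion u hu)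
    (S.differentiableAt hg hd) (S.rgrad_ne_zero g hg _ hd) ?_
  have hc : ContinuousAt θ u := (hθ.differentiableAt hu).continuousAt
  filter_upwards [hθ.isOpen.mem_nhds hu,
    hc.preimage_mem_nhds ((S.isOpen_dom g hg).mem_nhds hd)] with w h1 h2
  exact S.φ_eq_zero hg (hθ.mapsTo h1) h2

/-- Charts whose normal points to a constant side of the surface. -/
lemma exists_oriented_chart {g : Heis} (hg : g ∈ S.carrier) :
    ∃ O U θ π, IsChart S.carrier O U θ π ∧ g ∈ O ∧ O ⊆ S.dom g ∧
      ∃ s : ℝ, |s| = 1 ∧ ∀ u ∈ U, ∃ c : ℝ, 0 < c ∧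
        patchNormal θ u = (s * c) • rgrad (S.φ g) (θ u) := by
  obtain ⟨O, U, θ, π, hc, hgO, hOd, -, -⟩ := S.exists_chart hg univ_mem
  have hP := hc.isPatch
  -- The inner product of the two normals is continuous and never zero. Its sign at the centre is
  -- `s`, and the chart is shrunk to the open set where the sign persists.
  let b : ℝ × ℝ → ℝ := fun u => patchNormal θ u 0 * rgrad (S.φ g) (θ u) 0 +
    patchNormal θ u 1 * rgrad (S.φ g) (θ u) 1 + patchNormal θ u 2 * rgrad (S.φ g) (θ u) 2
  have hbc : ContinuousOn b U := by
    have h1 := continuousOn_frameCoord_fderiv hP.isOpen hP.contDiffOn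
    have h2 : ∀ V : Heis → Heis, ContDiff ℝ 1 V →
        ContinuousOn (fun u => along V (S.φ g) (θ u)) U := fun V hV u hu =>
      ((contDiffAt_along hV.contDiffAt (S.contDiffAt hg (hOd (hc.mapsTo_nhd hu)))).continuousAt.comp
        (f := θ) (hc.differentiableAt hu).continuousAt).continuousWithinAt
    simp only [b, patchNormal_zero, patchNormal_one, patchNormal_two]
    exact (((((h1 _ _).mul (h1 _ _)).sub ((h1 _ _).mul (h1 _ _))).mul (h2 X1 contDiff_X1)).add
      ((((h1 _ _).mul (h1 _ _)).sub ((h1 _ _).mul (h1 _ _))).mul (h2 X2 contDiff_X2))).add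
      ((((h1 _ _).mul (h1 _ _)).sub ((h1 _ _).mul (h1 _ _))).mul (h2 T contDiff_T))
  have hb : ∀ u ∈ U, ∃ c m : ℝ, c ≠ 0 ∧ 0 < m ∧ b u = c * m ∧
      patchNormal θ u = c • rgrad (S.φ g) (θ u) := by
    intro u hu
    obtain ⟨c, hc0, h⟩ := S.patchNormal_eq_smul hg hP hu (hOd (hc.mapsTo_nhd hu))
    refine ⟨c, rgrad (S.φ g) (θ u) ⬝ᵥ rgrad (S.φ g) (θ u), hc0, ?_, ?_, h⟩
    · refine lt_of_le_of_ne ?_ (Ne.symm ?_)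
      · exact Finset.sum_nonneg fun i _ => mul_self_nonneg _
      · rw [Ne, dotProduct_self_eq_zero]
        exact S.rgrad_ne_zero g hg _ (hOd (hc.mapsTo_nhd hu))
    · simp only [b, h, dotProduct, Fin.sum_univ_three, Pi.smul_apply, smul_eq_mul]
      ring
  obtain ⟨hu0, hθ0⟩ := hc.inv g ⟨hg, hgO⟩
  obtain ⟨c0, m0, hc0, hm0, hb0, -⟩ := hb _ hu0
  have hs : ∃ s : ℝ, |s| = 1 ∧ 0 < s * b (π g) := by
    rcases lt_or_gt_of_ne hc0 with h | h
    · refine ⟨-1, by simp, ?_⟩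
      rw [hb0]; nlinarith [mul_neg_of_neg_of_pos h hm0]
    · refine ⟨1, by simp, ?_⟩
      rw [hb0, one_mul]; exact mul_pos h hm0
  obtain ⟨s, hs1, hs0⟩ := hs
  have hUo : IsOpen (U ∩ (fun u => s * b u) ⁻¹' Set.Ioi 0) :=
    (continuousOn_const.mul hbc).isOpen_inter_preimage hP.isOpen isOpen_Ioi
  refine ⟨_, _, θ, π, hc.restrict hUo Set.inter_subset_left, ⟨hgO, hu0, hs0⟩,
    fun h hh => hOd hh.1, s, hs1, fun u hu => ?_⟩
  obtain ⟨c, m, -, hm, hbu, hN⟩ := hb u hu.1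
  have hss : s * s = 1 := by rw [← abs_mul_abs_self, hs1, one_mul]
  refine ⟨s * c, ?_, ?_⟩
  · have h1 : 0 < s * b u := hu.2
    rw [hbu, ← mul_assoc] at h1
    exact pos_of_mul_pos_left h1 hm.le
  · rw [← mul_assoc, hss, one_mul, hN]

/-- Stokes' formula for functions supported in the domain of a chart. -/
lemma integral_stokesDensity_chart (hS : S.charLocus = ∅) {g : Heis} (hg : g ∈ S.carrier) :
    ∃ O, IsOpen O ∧ g ∈ O ∧ ∀ f : Heis → ℝ, ContDiff ℝ 1 f → HasCompactSupport f →
      tsupport f ⊆ O →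
      ∫ h in S.carrier, stokesDensity (S.φ h) f h ∂(perimeter S.carrier) = 0 := by
  obtain ⟨O, U, θ, π, hc, hgO, hOd, s, hs, hN⟩ := S.exists_oriented_chart hg
  refine ⟨O, hc.isOpen_nhd, hgO, fun f hf hfc hfO => ?_⟩
  have hP := hc.isPatch
  have hdom : ∀ u ∈ U, θ u ∈ S.dom g := fun u hu => hOd (hc.mapsTo_nhd hu)
  have hW : ∀ u ∈ U, W (S.φ g) (θ u) ≠ 0 := fun u hu =>
    S.W_ne_zero hS hg (hc.mapsTo hu) (hdom u hu)
  have hzero : ∀ (φ : Heis → ℝ) (h : Heis), h ∉ tsupport f → stokesDensity φ f h = 0 := by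
    intro φ h hh
    have h1 : f h = 0 := image_eq_zero_of_notMem_tsupport hh
    have h2 : fderiv ℝ f h = 0 := by
      by_contra h0
      exact hh (support_fderiv_subset ℝ h0)
    simp [stokesDensity, h1, h2]
  -- reduction to the chart
  have hmeas := S.measurableSet_carrier
  have hcont := S.continuousOn_stokesDensity hS hf
  have hsm : AEStronglyMeasurable (fun h => stokesDensity (S.φ h) f h) (perimeter S.carrier) := by
    rw [← perimeter_restrict_self hmeas]
    exact hcont.aestronglyMeasurable hmeas
  have step1 : ∫ h in S.carrier, stokesDensity (S.φ h) f h ∂(perimeter S.carrier) =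
      ∫ u in U, density θ u * stokesDensity (S.φ g) f (θ u) := by
    rw [perimeter_restrict_self hmeas, ← setIntegral_eq_integral_of_forall_compl_eq_zero
      (s := O) (fun h hh => hzero _ h fun hh' => hh (hfO hh')), hc.perimeter_restrict,
      integral_patchPerimeter hP.isOpen hP.contDiffOn]
    · refine setIntegral_congr_fun hP.isOpen.measurableSet fun u hu => ?_
      rw [S.stokesDensity_eq_self hS f hg (hc.mapsTo hu) (hdom u hu)]
    · rw [← hc.perimeter_restrict]
      exact hsm.restrict
  rw [step1]
  -- the one-form
  let E : Fin 3 → Heis → ℝ := ![fun h => f h * (-(pbar (S.φ g) h * qbar (S.φ g) h ^ 2)),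
      fun h => f h * (pbar (S.φ g) h ^ 2 * qbar (S.φ g) h), fun h => f h * (-omegabar (S.φ g) h)]
  have hE : ∀ u ∈ U, ∀ i, ContDiffAt ℝ 1 (E i) (θ u) := by
    intro u hu i
    have c := S.contDiffAt hg (hdom u hu)
    have hp := contDiffAt_pbar c (hW u hu)
    have hq := contDiffAt_qbar c (hW u hu)
    have hω := contDiffAt_omegabar c (hW u hu)
    fin_cases i
    · exact hf.contDiffAt.mul (hp.mul (hq.pow 2)).neg
    · exact hf.contDiffAt.mul ((hp.pow 2).mul hq)
    · exact hf.contDiffAt.mul hω.neg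
  have hE0 : ∀ h, h ∉ tsupport f → ∀ i, E i h = 0 := by
    intro h hh i
    have h1 : f h = 0 := image_eq_zero_of_notMem_tsupport hh
    fin_cases i <;> simp [E, h1]
  -- The support as seen in the chart. It is compact because inside `O` the surface is closed, being
  -- the zero set of the defining function.
  let K : Set (ℝ × ℝ) := π '' (tsupport f ∩ S.carrier)
  have hKc : IsCompact K := by
    have h1 : tsupport f ∩ S.carrier = tsupport f ∩ S.φ g ⁻¹' {0} := by
      ext h
      exact ⟨fun hh => ⟨hh.1, S.φ_eq_zero hg hh.2 (hOd (hfO hh.1))⟩,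
        fun hh => ⟨hh.1, S.mem_carrier hg (hOd (hfO hh.1)) hh.2⟩⟩
    have h2 : IsClosed (tsupport f ∩ S.carrier) := by
      rw [h1]
      refine ContinuousOn.preimage_isClosed_of_isClosed ?_ (isClosed_tsupport f) isClosed_singleton
      exact fun h hh => (S.differentiableAt hg (hOd (hfO hh))).continuousAt.continuousWithinAt
    exact (hfc.isCompact.of_isClosed_subset h2 Set.inter_subset_left).image π.continuous
  have hKU : K ⊆ U := by
    rintro _ ⟨h, hh, rfl⟩
    exact (hc.inv h ⟨hh.2, hfO hh.1⟩).1
  have hK0 : ∀ u ∈ U, u ∉ K → θ u ∉ tsupport f := fun u hu hK hf' =>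
    hK ⟨θ u, ⟨hf', hc.mapsTo hu⟩, hc.proj_apply u hu⟩
  -- Extension by zero of the pulled-back form to the whole plane. It stays `C¹` because it vanishes
  -- off the compact set `K` inside the open set `U`.
  let G : ℝ × ℝ → ℝ × ℝ → ℝ := fun v => U.indicator (pullback θ E v)
  have hG0 : ∀ v u, u ∉ K → G v u = 0 := by
    intro v u hu
    by_cases hU : u ∈ U
    · simp only [G, Set.indicator_of_mem hU, pullback, hE0 _ (hK0 u hU hu), zero_mul, add_zero]
    · exact Set.indicator_of_notMem hU _
  have hGU : ∀ v, ∀ u ∈ U, G v =ᶠ[𝓝 u] pullback θ E v := fun v u hu => by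
    filter_upwards [hP.isOpen.mem_nhds hu] with w hw using Set.indicator_of_mem hw _
  have hGc : ∀ v, HasCompactSupport (G v) := fun v =>
    HasCompactSupport.intro hKc fun u hu => hG0 v u hu
  have hGd : ∀ v, ContDiff ℝ 1 (G v) := by
    intro v
    rw [contDiff_iff_contDiffAt]
    intro u
    by_cases hu : u ∈ U
    · refine ContDiffAt.congr_of_eventuallyEq ?_ (hGU v u hu)
      have c2 : ContDiffAt ℝ 2 θ u := hc.contDiffOn.contDiffAt (hc.isOpen.mem_nhds hu)
      have c1 : ContDiffAt ℝ 1 θ u := c2.of_le one_le_two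
      have cv : ContDiffAt ℝ 1 (fun u => fderiv ℝ θ u v) u :=
        (c2.fderiv_right (m := 1) (by norm_num)).clm_apply contDiffAt_const
      have ce : ∀ i, ContDiffAt ℝ 1 (fun u => E i (θ u)) u := fun i =>
        (hE u hu i).comp u c1
      exact (((ce 0).mul cv.fst).add ((ce 1).mul cv.snd.fst)).add ((ce 2).mul
        ((cv.snd.snd.add ((c1.snd.fst.div_const 2).mul cv.fst)).sub
          ((c1.fst.div_const 2).mul cv.snd.fst)))
    · have : G v =ᶠ[𝓝 u] fun _ => 0 := by
        filter_upwards [hKc.isClosed.isOpen_compl.mem_nhds fun h => hu (hKU h)] with w hw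
          using hG0 v w hw
      exact contDiffAt_const.congr_of_eventuallyEq this
  have hint : ∀ v w, Integrable fun u => fderiv ℝ (G v) u w := fun v w =>
    (((hGd v).continuous_fderiv one_ne_zero).clm_apply
      continuous_const).integrable_of_hasCompactSupport ((hGc v).fderiv_apply (𝕜 := ℝ) w)
  have hfin : ∫ u, s * (fderiv ℝ (G (0, 1)) u (1, 0) - fderiv ℝ (G (1, 0)) u (0, 1)) = 0 := by
    rw [integral_const_mul, integral_sub (hint _ _) (hint _ _),
      integral_fderiv_apply_eq_zero (hGd _) (hGc _), integral_fderiv_apply_eq_zero (hGd _) (hGc _),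
      sub_zero, mul_zero]
  rw [← hfin, ← integral_indicator hP.isOpen.measurableSet]
  refine integral_congr_ae (Eventually.of_forall fun u => ?_)
  simp only
  by_cases hu : u ∈ U
  · rw [Set.indicator_of_mem hu, (hGU _ u hu).fderiv_eq, (hGU _ u hu).fderiv_eq,
      fderiv_pullback_sub (hc.contDiffOn.contDiffAt (hc.isOpen.mem_nhds hu))
        (fun i => (hE u hu i).differentiableAt one_ne_zero),
      ← stokesDensity_eq_curl (S.contDiffAt hg (hdom u hu)) (hW u hu)
        (hf.differentiable one_ne_zero _) (E := E) rfl]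
    obtain ⟨c, hc0, hNu⟩ := hN u hu
    -- The normal equals `s · density · (p̄, q̄, ω̄)`, so the factor `s` placed in front of the
    -- exterior derivative cancels the orientation of the chart.
    have hss : s * s = 1 := by rw [← abs_mul_abs_self, hs, one_mul]
    have hdens : density θ u = c * W (S.φ g) (θ u) := by
      rw [density_eq_of_smul hNu, abs_mul, hs, one_mul, abs_of_pos hc0]
    have n0 : patchNormal θ u 0 = s * (density θ u * pbar (S.φ g) (θ u)) := by
      rw [hNu, hdens, pbar, mul_assoc c, mul_div_cancel₀ _ (hW u hu), ← mul_assoc]; rfl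
    have n1 : patchNormal θ u 1 = s * (density θ u * qbar (S.φ g) (θ u)) := by
      rw [hNu, hdens, qbar, mul_assoc c, mul_div_cancel₀ _ (hW u hu), ← mul_assoc]; rfl
    have n2 : patchNormal θ u 2 = s * (density θ u * omegabar (S.φ g) (θ u)) := by
      rw [hNu, hdens, omegabar, mul_assoc c, mul_div_cancel₀ _ (hW u hu), ← mul_assoc]; rfl
    rw [n0, n1, n2]
    linear_combination (-(density θ u) * (pbar (S.φ g) (θ u) * (along X2 (E 2) (θ u) -
      along T (E 1) (θ u)) + qbar (S.φ g) (θ u) * (along T (E 0) (θ u) - along X1 (E 2) (θ u)) +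
      omegabar (S.φ g) (θ u) *
        (along X1 (E 1) (θ u) - along X2 (E 0) (θ u) - E 2 (θ u)))) * hss
  · have : ∀ v, G v =ᶠ[𝓝 u] fun _ => 0 := fun v => by
      filter_upwards [hKc.isClosed.isOpen_compl.mem_nhds fun h => hu (hKU h)] with w hw
        using hG0 v w hw
    rw [Set.indicator_of_notMem hu, (this _).fderiv_eq, (this _).fderiv_eq]
    simp

end OrientedC2Surface

open scoped Manifold ContDiff

/-! ### Cutoffs -/

lemma exists_cutoff {K : Set Heis} (hK : IsCompact K) :
    ∃ χ : Heis → ℝ, ContDiff ℝ 2 χ ∧ HasCompactSupport χ ∧ ∀ g ∈ K, χ g = 1 := by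
  obtain ⟨K', hK', hKK'⟩ := exists_compact_superset hK
  obtain ⟨χ, h1, h0, -⟩ := exists_contMDiffMap_one_nhds_of_subset_interior (n := ⊤)
    𝓘(ℝ, Heis) hK.isClosed hKK'
  refine ⟨χ, contDiff_infty.1 χ.contMDiff.contDiff 2, ?_, fun g hg => ?_⟩
  · exact HasCompactSupport.intro hK' h0
  · exact (h1.self_of_nhdsSet) g hg

/-- A function which is `C¹` can be decomposed, over a compact set covered by open sets, into
finitely many compactly supported functions subordinate to the cover. -/
lemma exists_partition {K : Set Heis} (hK : IsCompact K) {O : Heis → Set Heis}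
    (hO : ∀ g ∈ K, IsOpen (O g) ∧ g ∈ O g) :
    ∃ (t : Finset Heis) (ρ : t → Heis → ℝ), (∀ i : t, (i : Heis) ∈ K ∧ ContDiff ℝ 1 (ρ i) ∧
      HasCompactSupport (ρ i) ∧ tsupport (ρ i) ⊆ O i) ∧ ∀ g ∈ K, ∑ i, ρ i g = 1 := by
  -- Intersecting with unit balls makes the supports bounded, hence compact.
  obtain ⟨t, htK, ht⟩ := hK.elim_nhds_subcover (fun g => O g ∩ Metric.ball g 1) fun g hg =>
    inter_mem ((hO g hg).1.mem_nhds (hO g hg).2) (Metric.ball_mem_nhds g one_pos)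
  obtain ⟨ρ, hρ⟩ := SmoothPartitionOfUnity.exists_isSubordinate 𝓘(ℝ, Heis) hK.isClosed
    (fun i : t => O i ∩ Metric.ball (i : Heis) 1)
    (fun i => (hO i (htK i i.2)).1.inter Metric.isOpen_ball) (by
      intro g hg
      obtain ⟨i, hi, hgi⟩ := Set.mem_iUnion₂.1 (ht hg)
      exact Set.mem_iUnion.2 ⟨⟨i, hi⟩, hgi⟩)
  refine ⟨t, fun i => ρ i, fun i : t => ⟨htK i i.2, ?_, ?_, ?_⟩, fun g hg => ?_⟩
  · exact (ρ i).contMDiff.contDiff.of_le (by exact_mod_cast le_top)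
  · refine (isCompact_closedBall (i : Heis) 1).of_isClosed_subset (isClosed_tsupport _) ?_
    exact (hρ i).trans (Set.inter_subset_right.trans Metric.ball_subset_closedBall)
  · exact (hρ i).trans Set.inter_subset_left
  · rw [← finsum_eq_sum_of_fintype]
    exact ρ.sum_eq_one hg

namespace OrientedC2Surface

variable (S : OrientedC2Surface)

lemma integrableOn_of_compact {K : Set Heis} (hK : IsCompact K) (hKS : K ⊆ S.carrier)
    (hfin : perimeter S.carrier K < ⊤) {F : Heis → ℝ} (hF : ContinuousOn F S.carrier)
    (h0 : ∀ g ∈ S.carrier, g ∉ K → F g = 0) :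
    IntegrableOn F S.carrier (perimeter S.carrier) := by
  have hm := S.measurableSet_carrier
  refine IntegrableOn.of_forall_sdiff_eq_zero (s := K) ?_ hm fun g hg => h0 g hg.1 hg.2
  obtain ⟨C, hC⟩ := hK.exists_bound_of_continuousOn (hF.mono hKS)
  refine Measure.integrableOn_of_bounded hfin.ne ?_
    (ae_restrict_of_forall_mem hK.measurableSet hC)
  rw [← perimeter_restrict_self hm]
  exact hF.aestronglyMeasurable hm

/-- Near a point of the surface outside a compact set, functions supported there vanish. -/
lemma eventually_notMem {K : Set Heis} (hK : IsCompact K) {f : Heis → ℝ}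
    (hf : ∀ g ∈ S.carrier, g ∉ K → f g = 0) {g : Heis} (hg : g ∉ K) :
    f =ᶠ[𝓝[S.carrier] g] fun _ => 0 := by
  filter_upwards [self_mem_nhdsWithin,
    mem_nhdsWithin_of_mem_nhds (hK.isClosed.isOpen_compl.mem_nhds hg)] with h h1 h2 using hf h h1 h2

/-- Off the surface nothing is assumed about the zeros of `f`, so its full differential may be
nonzero at `g`. Only tangential derivatives occur in `stokesDensity`, and those vanish. -/
lemma stokesDensity_eq_zero (hS : S.charLocus = ∅) {K : Set Heis} (hK : IsCompact K)
    {f : Heis → ℝ} (hf : ContDiff ℝ 1 f) (hf0 : ∀ g ∈ S.carrier, g ∉ K → f g = 0) {g : Heis}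
    (hg : g ∈ S.carrier) (hgK : g ∉ K) : stokesDensity (S.φ g) f g = 0 := by
  rw [S.stokesDensity_congr hS hg (hf.differentiable one_ne_zero g) (differentiableAt_const 0)
    (S.eventually_notMem hK hf0 hgK)]
  simp [stokesDensity]

lemma stokesDensity_sum {ι : Type*} (s : Finset ι) (φ : Heis → ℝ) (f : ι → Heis → ℝ) (g : Heis)
    (hf : ∀ i, DifferentiableAt ℝ (f i) g) :
    stokesDensity φ (fun h => ∑ i ∈ s, f i h) g = ∑ i ∈ s, stokesDensity φ (f i) g := by
  simp only [stokesDensity]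
  rw [fderiv_fun_sum fun i _ => hf i]
  simp only [_root_.sum_apply, Finset.mul_sum, Finset.sum_mul, Finset.sum_add_distrib,
    Finset.sum_sub_distrib]

/-- Stokes' formula on the surface. -/
lemma integral_stokesDensity (hS : S.charLocus = ∅) {K : Set Heis} (hK : IsCompact K)
    (hKS : K ⊆ S.carrier) (hfin : perimeter S.carrier K < ⊤) {f : Heis → ℝ} (hf : ContDiff ℝ 1 f)
    (hf0 : ∀ g ∈ S.carrier, g ∉ K → f g = 0) :
    IntegrableOn (fun h => stokesDensity (S.φ h) f h) S.carrier (perimeter S.carrier) ∧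
    ∫ h in S.carrier, stokesDensity (S.φ h) f h ∂(perimeter S.carrier) = 0 := by
  have hint : ∀ f : Heis → ℝ, ContDiff ℝ 1 f → (∀ g ∈ S.carrier, g ∉ K → f g = 0) →
      IntegrableOn (fun h => stokesDensity (S.φ h) f h) S.carrier (perimeter S.carrier) :=
    fun f hf hf0 => S.integrableOn_of_compact hK hKS hfin (S.continuousOn_stokesDensity hS hf)
      fun g hg hgK => S.stokesDensity_eq_zero hS hK hf hf0 hg hgK
  refine ⟨hint f hf hf0, ?_⟩
  -- Stated for all `g`, with `∅` as an idle value off `K`, so that `choose` gives a total function.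
  have hloc : ∀ g, ∃ O, g ∈ K → (IsOpen O ∧ g ∈ O ∧ ∀ f : Heis → ℝ, ContDiff ℝ 1 f →
      HasCompactSupport f → tsupport f ⊆ O →
      ∫ h in S.carrier, stokesDensity (S.φ h) f h ∂(perimeter S.carrier) = 0) := fun g => by
    by_cases hg : g ∈ K
    · obtain ⟨O, hO⟩ := S.integral_stokesDensity_chart hS (hKS hg)
      exact ⟨O, fun _ => hO⟩
    · exact ⟨∅, fun h => absurd h hg⟩
  choose O hO using hloc
  obtain ⟨t, ρ, hρ, hsum⟩ := exists_partition hK fun g hg => ⟨(hO g hg).1, (hO g hg).2.1⟩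
  have hρf : ∀ i, ContDiff ℝ 1 fun h => ρ i h * f h := fun i => (hρ i).2.1.mul hf
  have hρf0 : ∀ i, ∀ g ∈ S.carrier, g ∉ K → ρ i g * f g = 0 := fun i g hg hgK => by
    rw [hf0 g hg hgK, mul_zero]
  -- The functions `f` and `∑ ρᵢ f` agree on the surface but perhaps not around it;
  -- `stokesDensity_congr` needs no more.
  have heq : ∀ g ∈ S.carrier, stokesDensity (S.φ g) f g =
      ∑ i, stokesDensity (S.φ g) (fun h => ρ i h * f h) g := by
    intro g hg
    rw [← stokesDensity_sum Finset.univ (S.φ g) (fun i h => ρ i h * f h) g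
      fun i => (hρf i).differentiable one_ne_zero g]
    refine S.stokesDensity_congr hS hg (hf.differentiable one_ne_zero g)
      ((ContDiff.sum fun i _ => hρf i).differentiable one_ne_zero g) ?_
    filter_upwards [self_mem_nhdsWithin] with h hh
    rw [← Finset.sum_mul]
    by_cases hhK : h ∈ K
    · rw [hsum h hhK, one_mul]
    · rw [hf0 h hh hhK, mul_zero]
  rw [setIntegral_congr_fun S.measurableSet_carrier heq,
    integral_finsetSum _ fun i _ => hint _ (hρf i) (hρf0 i)]
  refine Finset.sum_eq_zero fun i _ => ?_
  exact (hO i (hρ i).1).2.2 _ (hρf i) (hρ i).2.2.1.mul_right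
    (tsupport_mul_subset_left.trans (hρ i).2.2.2)

end OrientedC2Surface

/-! ### The deformation as a diffeomorphism -/

/-- A compactly supported `C¹` field is Lipschitz, so for small `r` the deformation is a
perturbation of the identity with Lipschitz constant below `1`. It is then a homeomorphism, and its
differential is injective because `v = -r D𝒳 v` forces `‖v‖ ≤ |r| L ‖v‖`. -/
lemma exists_deform_homeomorph {𝒳 : Heis → Heis} (h𝒳 : ContDiff ℝ 1 𝒳)
    (hc : HasCompactSupport 𝒳) : ∃ δ > 0, ∀ r : ℝ, |r| < δ → ∃ Φ : Heis ≃ₜ Heis,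
      ⇑Φ = deform 𝒳 r ∧ ContDiff ℝ 1 Φ ∧ ContDiff ℝ 1 Φ.symm := by
  obtain ⟨L, hL⟩ := h𝒳.lipschitzWith_of_hasCompactSupport hc one_ne_zero
  -- The `+ 1` covers the case `L = 0`.
  refine ⟨1 / (L + 1), by positivity, fun r hr => ?_⟩
  have hrL : |r| * L < 1 := by
    have h1 : |r| * (L + 1) < 1 := by rwa [lt_div_iff₀ (by positivity)] at hr
    nlinarith [abs_nonneg r]
  have hC : ContDiff ℝ 1 (deform 𝒳 r) := contDiff_id.add (h𝒳.const_smul r)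
  have happ : ApproximatesLinearOn (deform 𝒳 r)
      ((ContinuousLinearEquiv.refl ℝ Heis : Heis ≃L[ℝ] Heis) : Heis →L[ℝ] Heis) Set.univ
      (‖r‖₊ * L) := by
    intro x _ y _
    have : deform 𝒳 r x - deform 𝒳 r y - (x - y) = r • (𝒳 x - 𝒳 y) := by
      simp only [deform, smul_sub]; abel
    simp only [ContinuousLinearEquiv.coe_refl, ContinuousLinearMap.id_apply]
    rw [this, norm_smul, NNReal.coe_mul, coe_nnnorm, mul_assoc]
    refine mul_le_mul_of_nonneg_left ?_ (norm_nonneg r)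
    simpa [dist_eq_norm] using hL.dist_le_mul x y
  let Φ : Heis ≃ₜ Heis := happ.toHomeomorph (deform 𝒳 r) (Or.inr (by
    have h1 : ‖((ContinuousLinearEquiv.refl ℝ Heis).symm : Heis →L[ℝ] Heis)‖₊ = 1 :=
      ContinuousLinearMap.nnnorm_id
    rw [h1, inv_one, ← NNReal.coe_lt_coe]
    simpa using hrL))
  have hΦ : ⇑Φ = deform 𝒳 r := rfl
  have hinj : ∀ g, Function.Injective (fderiv ℝ (deform 𝒳 r) g : Heis →ₗ[ℝ] Heis) := by
    intro g
    rw [← LinearMap.ker_eq_bot, LinearMap.ker_eq_bot']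
    intro v hv
    have hd : HasFDerivAt (deform 𝒳 r) (ContinuousLinearMap.id ℝ Heis + r • fderiv ℝ 𝒳 g) g :=
      (hasFDerivAt_id g).add ((h𝒳.differentiable one_ne_zero g).hasFDerivAt.const_smul r)
    rw [hd.fderiv] at hv
    have hv' : v + r • fderiv ℝ 𝒳 g v = 0 := hv
    have h1 : ‖v‖ ≤ |r| * L * ‖v‖ := by
      conv_lhs => rw [eq_neg_of_add_eq_zero_left hv', norm_neg, norm_smul, Real.norm_eq_abs]
      rw [mul_assoc]
      refine mul_le_mul_of_nonneg_left ?_ (abs_nonneg r)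
      exact (fderiv ℝ 𝒳 g).le_of_opNorm_le (norm_fderiv_le_of_lipschitz ℝ hL) v
    have h2 : ‖v‖ = 0 := by nlinarith [norm_nonneg v]
    exact norm_eq_zero.1 h2
  refine ⟨Φ, hΦ, hC, ?_⟩
  refine Φ.contDiff_symm (f₀' := fun g =>
    (LinearEquiv.ofInjectiveEndo _ (hinj g)).toContinuousLinearEquiv) (fun g => ?_) hC
  have h1 : (((LinearEquiv.ofInjectiveEndo _ (hinj g)).toContinuousLinearEquiv :
      Heis ≃L[ℝ] Heis) : Heis →L[ℝ] Heis) = fderiv ℝ (deform 𝒳 r) g :=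
    ContinuousLinearMap.ext fun v => rfl
  rw [h1]
  exact (hC.differentiable one_ne_zero g).hasFDerivAt

/-! ### The perimeter of the deformed surface -/

/-- The horizontal vectors orthogonal to `ν_H` form the line spanned by the unit vector `Z`, so the
projected gradient is `(Zf) Z`. -/
lemma tangentialGradSq_eq {φ f : Heis → ℝ} {g : Heis} (hW : W φ g ≠ 0) :
    tangentialGradSq φ f g = fderiv ℝ f g (Z φ g) ^ 2 := by
  have h0 := pbar_sq_add_qbar_sq hW
  rw [tangentialGradSq, fderiv_apply_Z]
  generalize pbar φ g = p at *
  generalize qbar φ g = q at *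
  linear_combination ((along X1 f g * p + along X2 f g * q) ^ 2 - along X1 f g ^ 2 -
    along X2 f g ^ 2) * h0

/-- The coefficient of `r` in the deformed normal. -/
def normalB (φ b : Heis → ℝ) (g : Heis) : ℝ := fderiv ℝ b g (Z φ g) + b g * omegabar φ g

/-- The coefficient of `r²` in the deformed normal. -/
def normalC (φ b : Heis → ℝ) (g : Heis) : ℝ :=
  b g * (omegabar φ g * along X1 b g - pbar φ g * along T b g)

/-- The factor by which the deformation multiplies the horizontal perimeter. -/
def jacobian (φ b : Heis → ℝ) (r : ℝ) (g : Heis) : ℝ :=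
  √(pbar φ g ^ 2 + (qbar φ g + r * normalB φ b g + r ^ 2 * normalC φ b g) ^ 2)

/-- The undeformed normal is `cW (p̄, q̄, ω̄)`, so the common factor `|cW|`, which is the old
density, comes out of the square root. The sign of `c` is irrelevant. -/
lemma density_deform {φ b : Heis → ℝ} {r c : ℝ} {θ : ℝ × ℝ → Heis} {u : ℝ × ℝ}
    (hb : DifferentiableAt ℝ b (θ u)) (hθ : DifferentiableAt ℝ θ u)
    (hΦ : DifferentiableAt ℝ (deform (fun g => b g • X1 g) r) (θ u)) (hW : W φ (θ u) ≠ 0)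
    (hN : patchNormal θ u = c • rgrad φ (θ u)) :
    density (deform (fun g => b g • X1 g) r ∘ θ) u =
      jacobian φ b r (θ u) * density θ u := by
  obtain ⟨h0, h1⟩ := patchNormal_deform hb hθ hΦ
  have n0 : patchNormal θ u 0 = c * W φ (θ u) * pbar φ (θ u) := by
    rw [hN, pbar, mul_assoc c, mul_div_cancel₀ _ hW]; rfl
  have n1 : patchNormal θ u 1 = c * W φ (θ u) * qbar φ (θ u) := by
    rw [hN, qbar, mul_assoc c, mul_div_cancel₀ _ hW]; rfl
  have n2 : patchNormal θ u 2 = c * W φ (θ u) * omegabar φ (θ u) := by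
    rw [hN, omegabar, mul_assoc c, mul_div_cancel₀ _ hW]; rfl
  have hWn : 0 ≤ W φ (θ u) := Real.sqrt_nonneg _
  have hd : density θ u = √((c * W φ (θ u)) ^ 2) := by
    rw [density_eq_of_smul hN, Real.sqrt_sq_eq_abs, abs_mul, abs_of_nonneg hWn]
  rw [hd, jacobian, ← Real.sqrt_mul (by positivity), density, h0, h1, n0, n1, n2, normalB, normalC,
    fderiv_apply_Z]
  congr 1
  ring

namespace OrientedC2Surface

variable (S : OrientedC2Surface)

lemma continuousOn_normalB (hS : S.charLocus = ∅) {b : Heis → ℝ} (hb : ContDiff ℝ 1 b) :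
    ContinuousOn (fun g => normalB (S.φ g) b g) S.carrier := by
  have hd : Continuous fun g => fderiv ℝ b g := hb.continuous_fderiv one_ne_zero
  have a1 : ContinuousOn (along X1 b) S.carrier :=
    (hd.clm_apply (contDiff_X1 (n := 1)).continuous).continuousOn
  have a2 : ContinuousOn (along X2 b) S.carrier :=
    (hd.clm_apply (contDiff_X2 (n := 1)).continuous).continuousOn
  simp only [normalB, fderiv_apply_Z]
  exact (((S.continuousOn_qbar hS).mul a1).sub ((S.continuousOn_pbar hS).mul a2)).add
    (hb.continuous.continuousOn.mul (S.continuousOn_omegabar hS))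

lemma continuousOn_normalC (hS : S.charLocus = ∅) {b : Heis → ℝ} (hb : ContDiff ℝ 1 b) :
    ContinuousOn (fun g => normalC (S.φ g) b g) S.carrier := by
  have hd : Continuous fun g => fderiv ℝ b g := hb.continuous_fderiv one_ne_zero
  have a1 : ContinuousOn (along X1 b) S.carrier :=
    (hd.clm_apply (contDiff_X1 (n := 1)).continuous).continuousOn
  have a3 : ContinuousOn (along T b) S.carrier :=
    (hd.clm_apply (contDiff_T (n := 1)).continuous).continuousOn
  exact hb.continuous.continuousOn.mul
    (((S.continuousOn_omegabar hS).mul a1).sub ((S.continuousOn_pbar hS).mul a3))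

lemma fderiv_Z_eq_zero_of_notMem {K : Set Heis} (hK : IsCompact K) {f : Heis → ℝ}
    (hf : Differentiable ℝ f) (hf0 : ∀ g ∈ S.carrier, g ∉ K → f g = 0) {g : Heis}
    (hg : g ∈ S.carrier) (hgK : g ∉ K) : fderiv ℝ f g (Z (S.φ g) g) = 0 := by
  rw [S.fderiv_eq_of_eventuallyEq hg (hf g) (differentiableAt_const 0)
    (S.eventually_notMem hK hf0 hgK) fderiv_Z_eq_zero]
  simp

/-- In `normalC` the value of `b` is a factor, while `normalB` differentiates `b` only along the
tangential field `Z`. Hence vanishing on the surface off `K` is enough. -/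
lemma normal_eq_zero {K : Set Heis} (hK : IsCompact K) {b : Heis → ℝ} (hb : Differentiable ℝ b)
    (hb0 : ∀ g ∈ S.carrier, g ∉ K → b g = 0) {g : Heis} (hg : g ∈ S.carrier) (hgK : g ∉ K) :
    normalB (S.φ g) b g = 0 ∧ normalC (S.φ g) b g = 0 := by
  rw [normalB, normalC, hb0 g hg hgK, S.fderiv_Z_eq_zero_of_notMem hK hb hb0 hg hgK]
  simp

lemma exists_bound_normal (hS : S.charLocus = ∅) {K : Set Heis} (hK : IsCompact K)
    (hKS : K ⊆ S.carrier) {b : Heis → ℝ} (hb : ContDiff ℝ 1 b)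
    (hb0 : ∀ g ∈ S.carrier, g ∉ K → b g = 0) :
    ∃ M, 1 ≤ M ∧ ∀ g ∈ S.carrier, |normalB (S.φ g) b g| ≤ M ∧ |normalC (S.φ g) b g| ≤ M := by
  obtain ⟨M1, h1⟩ := hK.exists_bound_of_continuousOn ((S.continuousOn_normalB hS hb).mono hKS)
  obtain ⟨M2, h2⟩ := hK.exists_bound_of_continuousOn ((S.continuousOn_normalC hS hb).mono hKS)
  refine ⟨max 1 (max M1 M2), le_max_left _ _, fun g hg => ?_⟩
  by_cases hgK : g ∈ K
  · exact ⟨(h1 g hgK).trans ((le_max_left _ _).trans (le_max_right _ _)),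
      (h2 g hgK).trans ((le_max_right _ _).trans (le_max_right _ _))⟩
  · obtain ⟨e1, e2⟩ := S.normal_eq_zero hK (hb.differentiable one_ne_zero) hb0 hg hgK
    rw [e1, e2, abs_zero]
    exact ⟨by positivity, by positivity⟩

lemma continuousOn_jacobian (hS : S.charLocus = ∅) {b : Heis → ℝ} (hb : ContDiff ℝ 1 b) (r : ℝ) :
    ContinuousOn (fun g => jacobian (S.φ g) b r g) S.carrier :=
  (((S.continuousOn_pbar hS).pow 2).add ((((S.continuousOn_qbar hS).add
    (continuousOn_const.mul (S.continuousOn_normalB hS hb))).add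
    (continuousOn_const.mul (S.continuousOn_normalC hS hb))).pow 2)).sqrt

/-- The perimeter of the deformed surface, as an integral over the surface. -/
lemma deformedPerimeter_eq_lintegral (hS : S.charLocus = ∅) {b : Heis → ℝ}
    (hb : ContDiff ℝ 1 b) {M r : ℝ} (hM : 1 ≤ M) (hr : |r| < 1 / (8 * M))
    (hbd : ∀ g ∈ S.carrier, |normalB (S.φ g) b g| ≤ M ∧ |normalC (S.φ g) b g| ≤ M)
    {Φ : Heis ≃ₜ Heis} (hΦ : ⇑Φ = deform (fun g => b g • X1 g) r) (hΦ1 : ContDiff ℝ 1 Φ)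
    (hΦ2 : ContDiff ℝ 1 Φ.symm) {E : Set Heis} (hE : MeasurableSet E) (hES : E ⊆ S.carrier) :
    deformedPerimeter S.carrier E (fun g => b g • X1 g) r =
      ∫⁻ g in E, ENNReal.ofReal (jacobian (S.φ g) b r g) ∂(perimeter S.carrier) := by
  classical
  have hm := S.measurableSet_carrier
  -- The factor is extended by `1` off the surface, to be measurable and positive everywhere, as
  -- `perimeter_image` asks.
  let j : Heis → ℝ := S.carrier.piecewise (fun g => jacobian (S.φ g) b r g) fun _ => 1
  have hjS : ∀ g ∈ S.carrier, j g = jacobian (S.φ g) b r g := fun g hg =>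
    Set.piecewise_eq_of_mem _ _ _ hg
  have hj : Measurable j :=
    (S.continuousOn_jacobian hS hb r).measurable_piecewise continuousOn_const hm
  have hj0 : ∀ g, 0 < j g := by
    intro g
    by_cases hg : g ∈ S.carrier
    · rw [hjS g hg]
      refine Real.sqrt_pos.2 ?_
      have := (sqrt_quadratic_bounds (pbar_sq_add_qbar_sq (S.W_self_ne_zero hS hg)) hM
        (hbd g hg).1 (hbd g hg).2 hr).1
      linarith
    · simp [j, hg]
  rw [deformedPerimeter, ← hΦ, perimeter_image Φ hΦ1 hΦ2 hj hj0,
    Measure.map_apply Φ.continuous.measurable (Φ.measurableEmbedding.measurableSet_image.2 hE),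
    Set.preimage_image_eq _ Φ.injective, withDensity_apply _ hE]
  · exact setLIntegral_congr_fun hE fun g hg => by simp only [hjS g (hES hg)]
  · intro U θ hP u hu
    have hg := hP.mapsTo hu
    obtain ⟨c, -, hN⟩ := S.patchNormal_eq_smul hg hP hu (S.mem_dom _ hg)
    rw [hjS _ hg, hΦ]
    exact density_deform (hb.differentiable one_ne_zero _) (hP.differentiableAt hu)
      (hΦ ▸ hΦ1.differentiable one_ne_zero _) (S.W_self_ne_zero hS hg) hN

/-- The `H`-perimeter of the deformed surface is `C²` in the parameter, and its second derivative
is obtained by differentiating the density. -/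
lemma deformedPerimeter_two_derivatives (hS : S.charLocus = ∅) {K : Set Heis} (hK : IsCompact K)
    (hKS : K ⊆ S.carrier) {b : Heis → ℝ} (hb : ContDiff ℝ 1 b) (hbc : HasCompactSupport b)
    (hb0 : ∀ g ∈ S.carrier, g ∉ K → b g = 0) {E : Set Heis} (hE : MeasurableSet E)
    (hES : E ⊆ S.carrier) (hEfin : perimeter S.carrier E < ⊤) :
    (∀ᶠ r in 𝓝 (0 : ℝ), deformedPerimeter S.carrier E (fun g => b g • X1 g) r < ⊤) ∧
    ContDiffAt ℝ 2
      (fun r : ℝ => (deformedPerimeter S.carrier E (fun g => b g • X1 g) r).toReal) 0 ∧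
    secondVariation S.carrier E (fun g => b g • X1 g) =
      ∫ g in E, (pbar (S.φ g) g ^ 2 * normalB (S.φ g) b g ^ 2 +
        2 * qbar (S.φ g) g * normalC (S.φ g) b g) ∂(perimeter S.carrier) := by
  obtain ⟨M, hM, hbd⟩ := S.exists_bound_normal hS hK hKS hb hb0
  obtain ⟨δ, hδ, hΦ⟩ := exists_deform_homeomorph (hb.smul contDiff_X1) (hbc.smul_right (f' := X1))
  have hM0 : 0 < M := by linarith
  -- The first radius makes the deformation a diffeomorphism; the second keeps the radicand away
  -- from zero.
  have hδ' : 0 < min δ (1 / (8 * M)) := lt_min hδ (by positivity)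
  have hball : ∀ r ∈ Metric.ball (0 : ℝ) (min δ (1 / (8 * M))), |r| < δ ∧ |r| < 1 / (8 * M) := by
    intro r hr
    rw [Metric.mem_ball, dist_zero_right, Real.norm_eq_abs] at hr
    exact lt_min_iff.1 hr
  have hfinite : IsFiniteMeasure ((perimeter S.carrier).restrict E) :=
    ⟨by rwa [Measure.restrict_apply_univ]⟩
  have hbounds : ∀ g ∈ E, ∀ r ∈ Metric.ball (0 : ℝ) (min δ (1 / (8 * M))), _ := fun g hg r hr =>
    sqrt_quadratic_bounds (pbar_sq_add_qbar_sq (S.W_self_ne_zero hS (hES hg))) hM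
      (hbd g (hES hg)).1 (hbd g (hES hg)).2 (hball r hr).2
  have hlint : ∀ r ∈ Metric.ball (0 : ℝ) (min δ (1 / (8 * M))),
      deformedPerimeter S.carrier E (fun g => b g • X1 g) r =
        ∫⁻ g in E, ENNReal.ofReal (jacobian (S.φ g) b r g) ∂(perimeter S.carrier) := by
    intro r hr
    obtain ⟨Φ, h1, h2, h3⟩ := hΦ r (hball r hr).1
    exact S.deformedPerimeter_eq_lintegral hS hb hM (hball r hr).2 hbd h1 h2 h3 hE hES
  have hq := (S.continuousOn_qbar hS).mono hES
  have hB := (S.continuousOn_normalB hS hb).mono hES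
  have hC := (S.continuousOn_normalC hS hb).mono hES
  have hJ : ∀ r, ContinuousOn (fun g => jacobian (S.φ g) b r g) E := fun r =>
    (S.continuousOn_jacobian hS hb r).mono hES
  have hQ : ∀ r : ℝ, ContinuousOn (fun g => qbar (S.φ g) g + r * normalB (S.φ g) b g +
      r ^ 2 * normalC (S.φ g) b g) E := fun r =>
    (hq.add (continuousOn_const.mul hB)).add (continuousOn_const.mul hC)
  have hQ' : ∀ r : ℝ, ContinuousOn (fun g => normalB (S.φ g) b g +
      2 * r * normalC (S.φ g) b g) E := fun r => hB.add (continuousOn_const.mul hC)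
  have hmF : ∀ F : Heis → ℝ, (AEMeasurable F ((perimeter S.carrier).restrict E)) →
      AEStronglyMeasurable F ((perimeter S.carrier).restrict E) := fun F h =>
    h.aestronglyMeasurable
  have hmJ : ∀ r, AEMeasurable (fun g => jacobian (S.φ g) b r g)
      ((perimeter S.carrier).restrict E) := fun r => (hJ r).aemeasurable hE
  have hder := contDiffAt_two_integral (μ := (perimeter S.carrier).restrict E)
    (F := fun r g => jacobian (S.φ g) b r g)
    (F' := fun r g => sqrtDeriv (pbar (S.φ g) g) (qbar (S.φ g) g) (normalB (S.φ g) b g)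
      (normalC (S.φ g) b g) r)
    (F'' := fun r g => sqrtDeriv2 (pbar (S.φ g) g) (qbar (S.φ g) g) (normalB (S.φ g) b g)
      (normalC (S.φ g) b g) r) (C := 200 * M ^ 2) hδ' (fun r => hmF _ (hmJ r))
    (fun r => hmF _ ((((hQ r).mul (hQ' r)).aemeasurable hE).div (hmJ r)))
    (fun r => hmF _ ((((((hQ' r).pow 2).add ((hQ r).mul
      (continuousOn_const.mul hC))).aemeasurable hE).div (hmJ r)).sub
      (((((hQ r).mul (hQ' r)).pow 2).aemeasurable hE).div ((hmJ r).pow_const 3))))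
    (ae_restrict_of_forall_mem hE fun g hg r hr => (hbounds g hg r hr).2)
    (ae_restrict_of_forall_mem hE fun g hg r hr => by
      have hpos : 0 < pbar (S.φ g) g ^ 2 + (qbar (S.φ g) g + r * normalB (S.φ g) b g +
          r ^ 2 * normalC (S.φ g) b g) ^ 2 := by linarith [(hbounds g hg r hr).1]
      refine ⟨hasDerivAt_sqrt_quadratic hpos, hasDerivAt_sqrtDeriv hpos, ?_⟩
      have hs := (Real.sqrt_pos.2 hpos).ne'
      unfold sqrtDeriv2
      refine ContinuousAt.sub (ContinuousAt.div (by fun_prop) (by fun_prop) hs)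
        (ContinuousAt.div (by fun_prop) (by fun_prop) (pow_ne_zero 3 hs)))
  have hev : (fun r : ℝ => (deformedPerimeter S.carrier E (fun g => b g • X1 g) r).toReal)
      =ᶠ[𝓝 0] fun r => ∫ g in E, jacobian (S.φ g) b r g ∂(perimeter S.carrier) := by
    filter_upwards [Metric.ball_mem_nhds (0 : ℝ) hδ'] with r hr
    rw [hlint r hr, integral_eq_lintegral_of_nonneg_ae
      (f := fun g => jacobian (S.φ g) b r g)
      (Eventually.of_forall fun g => Real.sqrt_nonneg _) (hmF _ (hmJ r))]
  refine ⟨?_, hder.1.congr_of_eventuallyEq hev, ?_⟩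
  · filter_upwards [Metric.ball_mem_nhds (0 : ℝ) hδ'] with r hr
    rw [hlint r hr]
    refine lt_of_le_of_lt (setLIntegral_mono_ae' (g := fun _ => ENNReal.ofReal (200 * M ^ 2)) hE
      (Eventually.of_forall fun g hg => ENNReal.ofReal_le_ofReal
        ((le_abs_self _).trans (hbounds g hg r hr).2.1))) ?_
    rw [setLIntegral_const]
    exact ENNReal.mul_lt_top ENNReal.ofReal_lt_top hEfin
  · rw [secondVariation, hev.iteratedDeriv_eq, hder.2]
    refine setIntegral_congr_fun hE fun g hg => ?_
    have h1 := pbar_sq_add_qbar_sq (S.W_self_ne_zero hS (hES hg))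
    simp only [sqrtDeriv2, zero_mul, mul_zero, add_zero, ne_eq, OfNat.ofNat_ne_zero,
      not_false_eq_true, zero_pow, h1, Real.sqrt_one, one_pow, div_one]
    -- At `r = 0` the root is `1` and the second derivative is `B² + 2q̄C - (q̄B)²`, where `1 - q̄²
    -- = p̄²`.
    linear_combination -(normalB (S.φ g) b g) ^ 2 * h1

end OrientedC2Surface

end Heisenberg

end

/-! ### The second variation formula -/

open Heisenberg
theorem lemma3p6 (S : OrientedC2Surface) (hS : S.charLocus = ∅)
    (a : Heis → ℝ) (ha : ContDiff ℝ 2 a)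
    (K : Set Heis) (hK : IsCompact K) (hKS : K ⊆ S.carrier)
    (haK : ∀ g ∈ S.carrier, g ∉ K → a g = 0)
    (E : Set Heis) (hE : MeasurableSet E) (hKE : K ⊆ E) (hES : E ⊆ S.carrier)
    (hEfin : perimeter S.carrier E < ⊤) :
    (∀ᶠ r in 𝓝 (0 : ℝ), deformedPerimeter S.carrier E (fun g => a g • X1 g) r < ⊤) ∧
    ContDiffAt ℝ 2
      (fun r : ℝ => (deformedPerimeter S.carrier E (fun g => a g • X1 g) r).toReal) 0 ∧
    IntegrableOn (fun g => pbar (S.φ g) g ^ 2 * tangentialGradSq (S.φ g) a g)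
      S.carrier (perimeter S.carrier) ∧
    IntegrableOn (fun g => a g ^ 2 * potential (S.φ g) g)
      S.carrier (perimeter S.carrier) ∧
    secondVariation S.carrier E (fun g => a g • X1 g) =
      (∫ g in S.carrier, pbar (S.φ g) g ^ 2 * tangentialGradSq (S.φ g) a g
        ∂(perimeter S.carrier)) +
      ∫ g in S.carrier, a g ^ 2 * potential (S.φ g) g ∂(perimeter S.carrier) := by
  have hm := S.measurableSet_carrier
  have hKfin : perimeter S.carrier K < ⊤ := (measure_mono hKE).trans_lt hEfin
  -- Off the surface `a` need not have compact support, which the diffeomorphism requires. The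
  -- product `χ a` does, and it coincides with `a` on the surface, hence moves the surface in the
  -- same way.
  obtain ⟨χ, hχ, hχc, hχ1⟩ := exists_cutoff hK
  have hab : ∀ g ∈ S.carrier, a g = χ g * a g := by
    intro g hg
    by_cases hgK : g ∈ K
    · rw [hχ1 g hgK, one_mul]
    · rw [haK g hg hgK, mul_zero]
  have hb : ContDiff ℝ 2 fun g => χ g * a g := hχ.mul ha
  have hb0 : ∀ g ∈ S.carrier, g ∉ K → χ g * a g = 0 := fun g hg hgK => by
    rw [← hab g hg, haK g hg hgK]
  have hb1 : ContDiff ℝ 1 fun g => χ g * a g := hb.of_le one_le_two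
  have ha1 : Differentiable ℝ a := ha.differentiable two_ne_zero
  have hper : ∀ r, deformedPerimeter S.carrier E (fun g => a g • X1 g) r =
      deformedPerimeter S.carrier E (fun g => (χ g * a g) • X1 g) r := by
    intro r
    have h : ∀ g ∈ S.carrier, deform (fun g => a g • X1 g) r g =
        deform (fun g => (χ g * a g) • X1 g) r g := fun g hg => by
      simp only [deform, ← hab g hg]
    rw [deformedPerimeter, deformedPerimeter, Set.image_congr h,
      Set.image_congr fun g hg => h g (hES hg)]
  have hvar : secondVariation S.carrier E (fun g => a g • X1 g) =
      secondVariation S.carrier E (fun g => (χ g * a g) • X1 g) := by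
    simp only [secondVariation, hper]
  have hgrad : ∀ g ∈ S.carrier, tangentialGradSq (S.φ g) a g =
      tangentialGradSq (S.φ g) (fun g => χ g * a g) g := by
    intro g hg
    have hW := S.W_self_ne_zero hS hg
    rw [tangentialGradSq_eq hW, tangentialGradSq_eq hW, S.fderiv_eq_of_eventuallyEq hg (ha1 g)
      (hb1.differentiable one_ne_zero g) ?_ fderiv_Z_eq_zero]
    filter_upwards [self_mem_nhdsWithin] with h hh using hab h hh
  have hpcont := S.continuousOn_pbar hS
  have hgradcont : ContinuousOn (fun g => tangentialGradSq (S.φ g) a g) S.carrier := by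
    have hd : Continuous fun g => fderiv ℝ a g := ha.continuous_fderiv two_ne_zero
    have a1 : ContinuousOn (along X1 a) S.carrier :=
      (hd.clm_apply (contDiff_X1 (n := 1)).continuous).continuousOn
    have a2 : ContinuousOn (along X2 a) S.carrier :=
      (hd.clm_apply (contDiff_X2 (n := 1)).continuous).continuousOn
    have hqcont := S.continuousOn_qbar hS
    exact ((a1.sub (((a1.mul hpcont).add (a2.mul hqcont)).mul hpcont)).pow 2).add
      ((a2.sub (((a1.mul hpcont).add (a2.mul hqcont)).mul hqcont)).pow 2)
  have hgrad0 : ∀ g ∈ S.carrier, g ∉ K → tangentialGradSq (S.φ g) a g = 0 := by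
    intro g hg hgK
    rw [tangentialGradSq_eq (S.W_self_ne_zero hS hg),
      S.fderiv_Z_eq_zero_of_notMem hK ha1 haK hg hgK]
    simp
  have hint1 : IntegrableOn (fun g => pbar (S.φ g) g ^ 2 * tangentialGradSq (S.φ g) a g)
      S.carrier (perimeter S.carrier) :=
    S.integrableOn_of_compact hK hKS hKfin ((hpcont.pow 2).mul hgradcont) fun g hg hgK => by
      rw [hgrad0 g hg hgK, mul_zero]
  have hint2 : IntegrableOn (fun g => a g ^ 2 * potential (S.φ g) g)
      S.carrier (perimeter S.carrier) :=
    S.integrableOn_of_compact hK hKS hKfin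
      ((ha.continuous.continuousOn.pow 2).mul (S.continuousOn_potential hS)) fun g hg hgK => by
      rw [haK g hg hgK]; simp
  obtain ⟨hfin, hC2, hsv⟩ := S.deformedPerimeter_two_derivatives hS hK hKS hb1 hχc.mul_right hb0
    hE hES hEfin
  obtain ⟨hst1, hst2⟩ := S.integral_stokesDensity hS hK hKS hKfin (hb1.pow 2)
    fun g hg hgK => by rw [hb0 g hg hgK]; simp
  simp only [← hper] at hfin hC2
  refine ⟨hfin, hC2, hint1, hint2, ?_⟩
  -- The integrand vanishes on the surface outside `K`, so integration over `E` may be replaced by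
  -- integration over the whole surface, where Stokes' formula applies.
  rw [hvar, hsv, ← setIntegral_eq_of_subset_of_forall_sdiff_eq_zero hm hES fun g hg => ?_]
  · have hsum : ∀ g ∈ S.carrier, pbar (S.φ g) g ^ 2 *
        normalB (S.φ g) (fun g => χ g * a g) g ^ 2 +
          2 * qbar (S.φ g) g * normalC (S.φ g) (fun g => χ g * a g) g =
        pbar (S.φ g) g ^ 2 * tangentialGradSq (S.φ g) a g + a g ^ 2 * potential (S.φ g) g +
          stokesDensity (S.φ g) (fun x => (χ x * a x) ^ 2) g := fun g hg => by
      have := second_variation_density (S.W_self_ne_zero hS hg)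
        (hb1.differentiable one_ne_zero g)
      rw [← hgrad g hg] at this
      rw [normalB, normalC, this, ← hab g hg]
    rw [setIntegral_congr_fun hm hsum]
    refine (integral_add (hint1.add hint2) hst1).trans ?_
    rw [hst2, add_zero]
    exact integral_add hint1 hint2
  · have h2 : g ∉ K := fun h => hg.2 (hKE h)
    obtain ⟨e1, e2⟩ := S.normal_eq_zero hK (hb1.differentiable one_ne_zero) hb0 hg.1 h2
    rw [e1, e2]
    simp
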